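/- There is a deterministic algorithm which, given a connected undirected unweighted simple graph $G$ with $n\ge 1$ vertices and $m$ edges by its adjacency lists (in an arbitrary order), computes an integer $\hat D$ such that $$\Big\lfloor \frac{4D}{5}\Big\rfloor \;\le\; \hat D \;\le\; D ,$$ where $D$ is the diameter of $G$, and whose worst-case running time is $\tilde O\big(m^{2/3}n^{4/3}\big)$. Precisely: there are a single program for the word RAM with words of $O(\log n)$ bits (elementary operations: reading and writing registers and array cells, constants, addition, truncated subtraction, multiplication, comparison, and branching on a test) and constants $C,k$, all independent of the graph, such that on every input of the above form the program halts with such a $\hat D$ as its output, and for $n\ge 2$ it does so after at most $C\,m^{2/3}n^{4/3}(\log n)^k$ elementary operations. -/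

import Mathlib

/-! A deterministic word RAM, presented as a structured programming language.  A program uses
finitely many registers and finitely many arrays (the names that occur in its text); every register
and every array cell holds a natural number of at most `w` bits, where `w` is the word length. -/

namespace WordRAM

/-- The contents of the registers (indexed by name) and of the arrays (name, then position). -/
structure State where
  reg : ℕ → ℕ
  arr : ℕ → ℕ → ℕ

/-- Expressions.  The constants, the register names and the array names are part of the program
text; array positions are computed. -/
inductive Expr where
  | lit (k : ℕ)
  | reg (x : ℕ)
  | cell (a : ℕ) (i : Expr)
  | add (e f : Expr)
  | sub (e f : Expr)
  | mul (e f : Expr)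
  | lt (e f : Expr)
  | eq (e f : Expr)

namespace Expr

/-- The value of an expression; `sub` is truncated at `0`, and the comparisons return `1` for true
and `0` for false. -/
def eval (s : State) : Expr → ℕ
  | lit k => k
  | reg x => s.reg x
  | cell a i => s.arr a (i.eval s)
  | add e f => e.eval s + f.eval s
  | sub e f => e.eval s - f.eval s
  | mul e f => e.eval s * f.eval s
  | lt e f => if e.eval s < f.eval s then 1 else 0
  | eq e f => if e.eval s = f.eval s then 1 else 0

/-- The values of the expression and of all its subexpressions (in particular, all array positions
that are accessed) fit into words of `w` bits. -/
def Fits (w : ℕ) (s : State) : Expr → Prop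
  | lit k => k < 2 ^ w
  | reg x => s.reg x < 2 ^ w
  | cell a i => i.Fits w s ∧ s.arr a (i.eval s) < 2 ^ w
  | add e f => e.Fits w s ∧ f.Fits w s ∧ e.eval s + f.eval s < 2 ^ w
  | sub e f => e.Fits w s ∧ f.Fits w s
  | mul e f => e.Fits w s ∧ f.Fits w s ∧ e.eval s * f.eval s < 2 ^ w
  | lt e f => e.Fits w s ∧ f.Fits w s ∧ 1 < 2 ^ w
  | eq e f => e.Fits w s ∧ f.Fits w s ∧ 1 < 2 ^ w

/-- The number of elementary operations performed when the expression is evaluated: one for each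
constant, register access, array access, arithmetic operation and comparison in it. -/
def cost : Expr → ℕ
  | lit _ => 1
  | reg _ => 1
  | cell _ i => i.cost + 1
  | add e f => e.cost + f.cost + 1
  | sub e f => e.cost + f.cost + 1
  | mul e f => e.cost + f.cost + 1
  | lt e f => e.cost + f.cost + 1
  | eq e f => e.cost + f.cost + 1

end Expr

/-- Programs. -/
inductive Program where
  | skip
  | assign (x : ℕ) (e : Expr)
  | store (a : ℕ) (i e : Expr)
  | seq (P Q : Program)
  | cond (b : Expr) (P Q : Program)
  | loop (b : Expr) (P : Program)

/-- The state after writing `v` into register `x`. -/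
def State.setReg (s : State) (x v : ℕ) : State :=
  { s with reg := Function.update s.reg x v }

/-- The state after writing `v` into position `i` of array `a`. -/
def State.setArr (s : State) (a i v : ℕ) : State :=
  { s with arr := Function.update s.arr a (Function.update (s.arr a) i v) }

/-- `Exec w P s t s'`: with words of `w` bits, the program `P` started in state `s` halts after
exactly `t` elementary steps, in state `s'`.  There is no execution if `P` does not terminate on
`s` or if some computed value or address does not fit into a word.  Guards are true when nonzero,
and each evaluation of a guard is charged. -/
inductive Exec (w : ℕ) : Program → State → ℕ → State → Prop where
  | skip (s : State) : Exec w .skip s 1 s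
  | assign (s : State) (x : ℕ) (e : Expr) (he : e.Fits w s) :
      Exec w (.assign x e) s (e.cost + 1) (s.setReg x (e.eval s))
  | store (s : State) (a : ℕ) (i e : Expr) (hi : i.Fits w s) (he : e.Fits w s) :
      Exec w (.store a i e) s (i.cost + e.cost + 1) (s.setArr a (i.eval s) (e.eval s))
  | seq {P Q : Program} {s s' s'' : State} {t t' : ℕ}
      (hP : Exec w P s t s') (hQ : Exec w Q s' t' s'') :
      Exec w (.seq P Q) s (t + t') s''
  | condTrue {b : Expr} {P Q : Program} {s s' : State} {t : ℕ}
      (hb : b.Fits w s) (h : b.eval s ≠ 0) (hP : Exec w P s t s') :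
      Exec w (.cond b P Q) s (b.cost + 1 + t) s'
  | condFalse {b : Expr} {P Q : Program} {s s' : State} {t : ℕ}
      (hb : b.Fits w s) (h : b.eval s = 0) (hQ : Exec w Q s t s') :
      Exec w (.cond b P Q) s (b.cost + 1 + t) s'
  | loopTrue {b : Expr} {P : Program} {s s' s'' : State} {t t' : ℕ}
      (hb : b.Fits w s) (h : b.eval s ≠ 0) (hP : Exec w P s t s')
      (hL : Exec w (.loop b P) s' t' s'') :
      Exec w (.loop b P) s (b.cost + 1 + t + t') s''
  | loopFalse {b : Expr} {P : Program} {s : State}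
      (hb : b.Fits w s) (h : b.eval s = 0) :
      Exec w (.loop b P) s (b.cost + 1) s

end WordRAM

/-- Adjacency lists of a graph on the vertices `0, …, n - 1`: for every vertex a list of its
neighbours, each occurring once, in an arbitrary order. -/
structure AdjacencyLists {n : ℕ} (G : SimpleGraph (Fin n)) where
  nbrs : Fin n → List (Fin n)
  nodup : ∀ u, (nbrs u).Nodup
  mem_nbrs : ∀ u v, v ∈ nbrs u ↔ G.Adj u v

namespace AdjacencyLists

variable {n : ℕ} {G : SimpleGraph (Fin n)}

/-- The concatenation of the lists of the vertices `0, …, n - 1`. -/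
def flat (L : AdjacencyLists G) : List ℕ :=
  (List.ofFn L.nbrs).flatten.map Fin.val

/-- The position in `L.flat` at which the list of vertex `i` starts; for `i = n`, the total length. -/
def start (L : AdjacencyLists G) (i : ℕ) : ℕ :=
  (((List.ofFn L.nbrs).take i).map List.length).sum

/-- The initial state for the input `L`: register `0` holds `n`, array `0` holds the numbers
`L.start 0, …, L.start n`, array `1` holds `L.flat`, and everything else is `0`. -/
def input (L : AdjacencyLists G) : WordRAM.State where
  reg x := if x = 0 then n else 0
  arr a i :=
    if a = 0 then (if i ≤ n then L.start i else 0)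
    else if a = 1 then L.flat.getD i 0
    else 0

end AdjacencyLists

/-!
The program combines three estimates of the diameter `D` of a connected graph with `n` vertices
and `m` edges, all bounded by `D`, and returns the largest. Let `S` be the least positive integer
with `n S ^ 3 ≥ 2 m`, so that `S` is `(m / n) ^ (1 / 3)` up to a constant factor, and call a
vertex of degree at least `S` high and any other vertex low.

*Dominators.* Repeatedly choose the vertex with the most high neighbours that are not yet
dominated. By double counting, each choice dominates at least a fraction `S / n` of those that are
left, so `O((n / S) log n)` choices dominate all high vertices (`wp_greedy`, with the bound
`roundBound`). A breadth-first search from each chosen vertex takes time `O(n + m)`. It gives an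
estimate that is at least `D / 2`, and at least `D - 1` if an end of a diametral pair is high, as
that end has a neighbour from which the search is made.

*Low pairs.* For every pair of low vertices, the at most `S ^ 2` pairs of their neighbours show
whether their distance is at most three (`Net.dist_le_three_iff`). If it is not for some pair,
then `4` is an estimate (`wp_checkPairs`).

*Surplus two.* For each vertex `u`, a high vertex gets as its label the distance from `u` to its
dominator plus one. Lowering the labels along the edges at low vertices gives labels that exceed
the distances from `u` by at most two: consider the last high vertex on a shortest path
(`Net.label_le`). A bucket queue does this in time `O(n S)` (`wp_lowerLabels`). The maximum label
minus two is an estimate that is at least `D - 2` for some `u` (`wp_surplusRows`).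

Hence the result is at least `max (D / 2) (D - 2)`, and at least `D - 1` or `4` if `D ≥ 4`, which
makes it at least `⌊4 D / 5⌋` (`Net.estimate_ge`). The time is
`O((n + m) (n / S) log n + n ^ 2 S ^ 2)` (`wp_diameterEstimate`), which is
`O(m ^ (2 / 3) n ^ (4 / 3) log n)` by the choice of `S`
(`running_time_le`).

Programs are treated by a calculus of preconditions with time bounds, `wp`. Its rules for loops,
`wp_loop` and `wp_forTo`, charge the time to a potential or to the counter. A step preserves the
property `Bdd` that all registers and cells hold words, so that only constants, sums and products
need to be checked for overflow (`Expr.Ok`), and it preserves the registers and arrays that do not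
occur as targets in the program text (`Exec.frame`).
-/

namespace WordRAM

/-! ### Reasoning about programs -/

attribute [simp] Expr.eval Expr.cost

/-- The number of words of `w` bits. -/
def size (w : ℕ) : ℕ := 2 ^ w

namespace Expr

/-- The part of `Expr.Fits` that is left to check when every register and every array cell is known
to hold a word: the constants, sums and products have to fit. -/
@[simp]
def Ok (w : ℕ) (s : State) : Expr → Prop
  | lit k => k < size w
  | reg _ => True
  | cell _ i => i.Ok w s
  | add e f => e.Ok w s ∧ f.Ok w s ∧ e.eval s + f.eval s < size w
  | sub e f => e.Ok w s ∧ f.Ok w s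
  | mul e f => e.Ok w s ∧ f.Ok w s ∧ e.eval s * f.eval s < size w
  | lt e f => e.Ok w s ∧ f.Ok w s
  | eq e f => e.Ok w s ∧ f.Ok w s

end Expr

/-- All registers and array cells hold words of `w` bits, and `w` is positive. -/
structure Bdd (w : ℕ) (s : State) : Prop where
  one_lt : 1 < size w
  reg : ∀ x, s.reg x < size w
  arr : ∀ a i, s.arr a i < size w

namespace Expr

theorem Ok.fits {w : ℕ} {s : State} (hb : Bdd w s) {e : Expr} (h : e.Ok w s) : e.Fits w s := by
  induction e with
  | lit k => exact h
  | reg x => exact hb.reg x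
  | cell a i ih => exact ⟨ih h, hb.arr _ _⟩
  | add e f ihe ihf => exact ⟨ihe h.1, ihf h.2.1, h.2.2⟩
  | sub e f ihe ihf => exact ⟨ihe h.1, ihf h.2⟩
  | mul e f ihe ihf => exact ⟨ihe h.1, ihf h.2.1, h.2.2⟩
  | lt e f ihe ihf => exact ⟨ihe h.1, ihf h.2, hb.one_lt⟩
  | eq e f ihe ihf => exact ⟨ihe h.1, ihf h.2, hb.one_lt⟩

theorem Fits.ok {w : ℕ} {s : State} {e : Expr} (h : e.Fits w s) : e.Ok w s := by
  induction e with
  | lit k => exact h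
  | reg x => exact trivial
  | cell a i ih => exact ih h.1
  | add e f ihe ihf => exact ⟨ihe h.1, ihf h.2.1, h.2.2⟩
  | sub e f ihe ihf => exact ⟨ihe h.1, ihf h.2⟩
  | mul e f ihe ihf => exact ⟨ihe h.1, ihf h.2.1, h.2.2⟩
  | lt e f ihe ihf => exact ⟨ihe h.1, ihf h.2.1⟩
  | eq e f ihe ihf => exact ⟨ihe h.1, ihf h.2.1⟩

theorem Fits.eval_lt {w : ℕ} {s : State} {e : Expr} (h : e.Fits w s) : e.eval s < 2 ^ w := by
  induction e with
  | lit k => exact h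
  | reg x => exact h
  | cell a i ih => exact h.2
  | add e f ihe ihf => exact h.2.2
  | sub e f ihe ihf => exact lt_of_le_of_lt (Nat.sub_le _ _) (ihe h.1)
  | mul e f ihe ihf => exact h.2.2
  | lt e f ihe ihf =>
    have := h.2.2
    simp only [eval]; split <;> omega
  | eq e f ihe ihf =>
    have := h.2.2
    simp only [eval]; split <;> omega

end Expr

@[simp]
theorem setReg_reg (s : State) (x v y : ℕ) :
    (s.setReg x v).reg y = if y = x then v else s.reg y := by
  simp [State.setReg, Function.update_apply]

@[simp]
theorem setReg_arr (s : State) (x v : ℕ) : (s.setReg x v).arr = s.arr := rfl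

@[simp]
theorem setArr_reg (s : State) (a i v : ℕ) : (s.setArr a i v).reg = s.reg := rfl

@[simp]
theorem setArr_arr (s : State) (a i v b : ℕ) :
    (s.setArr a i v).arr b = if b = a then Function.update (s.arr a) i v else s.arr b := by
  simp only [State.setArr, Function.update_apply]

theorem Bdd.setReg {w : ℕ} {s : State} (h : Bdd w s) (x : ℕ) {v : ℕ} (hv : v < size w) :
    Bdd w (s.setReg x v) := by
  refine ⟨h.one_lt, fun y => ?_, h.arr⟩
  rw [setReg_reg]; split
  · exact hv
  · exact h.reg y

theorem Bdd.setArr {w : ℕ} {s : State} (h : Bdd w s) (a i : ℕ) {v : ℕ} (hv : v < size w) :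
    Bdd w (s.setArr a i v) := by
  refine ⟨h.one_lt, h.reg, fun b j => ?_⟩
  rw [setArr_arr]; split
  · rw [Function.update_apply]; split
    · exact hv
    · exact h.arr a j
  · exact h.arr b j

theorem Exec.bdd {w : ℕ} {P : Program} {s s' : State} {t : ℕ} (h : Exec w P s t s')
    (hb : Bdd w s) : Bdd w s' := by
  induction h with
  | skip => exact hb
  | assign s x e he => exact hb.setReg x he.eval_lt
  | store s a i e hi he => exact hb.setArr a _ he.eval_lt
  | seq _ _ ih ih' => exact ih' (ih hb)
  | condTrue _ _ _ ih => exact ih hb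
  | condFalse _ _ _ ih => exact ih hb
  | loopTrue _ _ _ _ ih ih' => exact ih' (ih hb)
  | loopFalse => exact hb

namespace Program

/-- Whether the program text contains an assignment to register `x`. -/
def wr : Program → ℕ → Bool
  | skip, _ => false
  | assign y _, x => x == y
  | store _ _ _, _ => false
  | seq P Q, x => P.wr x || Q.wr x
  | cond _ P Q, x => P.wr x || Q.wr x
  | loop _ P, x => P.wr x

/-- Whether the program text contains a store into array `a`. -/
def wa : Program → ℕ → Bool
  | skip, _ => false
  | assign _ _, _ => false
  | store b _ _, a => a == b
  | seq P Q, a => P.wa a || Q.wa a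
  | cond _ P Q, a => P.wa a || Q.wa a
  | loop _ P, a => P.wa a

end Program

/-- The frame condition: `s'` agrees with `s` on the registers and arrays that `P` never writes. -/
structure Fr (P : Program) (s s' : State) : Prop where
  reg : ∀ x, P.wr x = false → s'.reg x = s.reg x
  arr : ∀ a, P.wa a = false → s'.arr a = s.arr a

theorem Fr.refl (P : Program) (s : State) : Fr P s s := ⟨fun _ _ => rfl, fun _ _ => rfl⟩

theorem Fr.trans {P : Program} {s s' s'' : State} (h : Fr P s s') (h' : Fr P s' s'') :
    Fr P s s'' :=
  ⟨fun x hx => (h'.reg x hx).trans (h.reg x hx), fun a ha => (h'.arr a ha).trans (h.arr a ha)⟩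

theorem Fr.mono {P Q : Program} {s s' : State} (h : Fr P s s')
    (hr : ∀ x, Q.wr x = false → P.wr x = false) (ha : ∀ a, Q.wa a = false → P.wa a = false) :
    Fr Q s s' :=
  ⟨fun x hx => h.reg x (hr x hx), fun a h' => h.arr a (ha a h')⟩

theorem Exec.frame {w : ℕ} {P : Program} {s s' : State} {t : ℕ} (h : Exec w P s t s') :
    Fr P s s' := by
  induction h with
  | skip => exact Fr.refl _ _
  | assign s x e he =>
    refine ⟨fun y hy => ?_, fun _ _ => rfl⟩
    have : y ≠ x := by simpa [Program.wr] using hy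
    simp [setReg_reg, this]
  | store s a i e hi he =>
    refine ⟨fun _ _ => rfl, fun b hb => ?_⟩
    have : b ≠ a := by simpa [Program.wa] using hb
    simp [setArr_arr, this]
  | seq _ _ ih ih' =>
    refine (ih.mono (Q := .seq _ _) ?_ ?_).trans (ih'.mono ?_ ?_) <;>
      (simp only [Program.wr, Program.wa, Bool.or_eq_false_iff]; tauto)
  | condTrue _ _ _ ih =>
    refine ih.mono ?_ ?_ <;> (simp only [Program.wr, Program.wa, Bool.or_eq_false_iff]; tauto)
  | condFalse _ _ _ ih =>
    refine ih.mono ?_ ?_ <;> (simp only [Program.wr, Program.wa, Bool.or_eq_false_iff]; tauto)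
  | loopTrue _ _ _ _ ih ih' =>
    exact (ih.mono (Q := .loop _ _) (fun _ h => h) (fun _ h => h)).trans ih'
  | loopFalse => exact Fr.refl _ _

/-- Total correctness with running time: started in `s`, a state of words, the program `P` halts,
and the number of steps and the final state satisfy `Q`. -/
def wp (w : ℕ) (P : Program) (s : State) (Q : ℕ → State → Prop) : Prop :=
  Bdd w s → ∃ t s', Exec w P s t s' ∧ Bdd w s' ∧ Q t s'

section rules

variable {w : ℕ} {P P' : Program} {s : State} {Q : ℕ → State → Prop}

theorem wp_bdd (h : Bdd w s → wp w P s Q) : wp w P s Q := fun hb => h hb hb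

theorem wp_conseq {Q' : ℕ → State → Prop} (h : wp w P s Q)
    (hQ : ∀ t s', Fr P s s' → Bdd w s' → Q t s' → Q' t s') : wp w P s Q' := fun hb => by
  obtain ⟨t, s', hE, hb', hq⟩ := h hb
  exact ⟨t, s', hE, hb', hQ t s' hE.frame hb' hq⟩

@[simp]
theorem wp_skip : wp w .skip s Q ↔ (Bdd w s → Q 1 s) := by
  refine ⟨fun h hb => ?_, fun h hb => ⟨_, _, .skip s, hb, h hb⟩⟩
  obtain ⟨t, s', hE, -, hq⟩ := h hb
  cases hE; exact hq

@[simp]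
theorem wp_assign {x : ℕ} {e : Expr} :
    wp w (.assign x e) s Q ↔ (Bdd w s → e.Ok w s ∧ Q (e.cost + 1) (s.setReg x (e.eval s))) := by
  constructor
  · intro h hb
    obtain ⟨t, s', hE, -, hq⟩ := h hb
    cases hE with
    | assign _ _ _ he => exact ⟨he.ok, hq⟩
  · intro h hb
    obtain ⟨h1, h2⟩ := h hb
    have hf := h1.fits hb
    exact ⟨_, _, .assign s x e hf, hb.setReg x hf.eval_lt, h2⟩

@[simp]
theorem wp_store {a : ℕ} {i e : Expr} :
    wp w (.store a i e) s Q ↔ (Bdd w s → i.Ok w s ∧ e.Ok w s ∧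
      Q (i.cost + e.cost + 1) (s.setArr a (i.eval s) (e.eval s))) := by
  constructor
  · intro h hb
    obtain ⟨t, s', hE, -, hq⟩ := h hb
    cases hE with
    | store _ _ _ _ hi he => exact ⟨hi.ok, he.ok, hq⟩
  · intro h hb
    obtain ⟨h1, h2, h3⟩ := h hb
    have hf := h2.fits hb
    exact ⟨_, _, .store s a i e (h1.fits hb) hf, hb.setArr a _ hf.eval_lt, h3⟩

@[simp]
theorem wp_seq :
    wp w (.seq P P') s Q ↔ wp w P s (fun t s' => wp w P' s' (fun t' s'' => Q (t + t') s'')) := by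
  constructor
  · intro h hb
    obtain ⟨t, s', hE, hb', hq⟩ := h hb
    cases hE with
    | seq h1 h2 => exact ⟨_, _, h1, h1.bdd hb, fun _ => ⟨_, _, h2, hb', hq⟩⟩
  · intro h hb
    obtain ⟨t, s', hE, hb', h'⟩ := h hb
    obtain ⟨t', s'', hE', hb'', hq⟩ := h' hb'
    exact ⟨_, _, hE.seq hE', hb'', hq⟩

@[simp]
theorem wp_cond {b : Expr} :
    wp w (.cond b P P') s Q ↔ ((Bdd w s → b.Ok w s) ∧
      (b.eval s ≠ 0 → wp w P s (fun t s' => Q (b.cost + 1 + t) s')) ∧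
      (b.eval s = 0 → wp w P' s (fun t s' => Q (b.cost + 1 + t) s'))) := by
  constructor
  · intro h
    refine ⟨fun hb => ?_, fun h0 hb => ?_, fun h0 hb => ?_⟩ <;>
      obtain ⟨t, s', hE, hb', hq⟩ := h hb <;> cases hE with
      | condTrue h1 h2 h3 =>
        first
        | exact h1.ok
        | exact ⟨_, _, h3, hb', hq⟩
        | exact absurd h0 h2
      | condFalse h1 h2 h3 =>
        first
        | exact h1.ok
        | exact ⟨_, _, h3, hb', hq⟩
        | exact absurd h2 h0
  · rintro ⟨h1, h2, h3⟩ hb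
    by_cases h0 : b.eval s = 0
    · obtain ⟨t, s', hE, hb', hq⟩ := h3 h0 hb
      exact ⟨_, _, .condFalse ((h1 hb).fits hb) h0 hE, hb', hq⟩
    · obtain ⟨t, s', hE, hb', hq⟩ := h2 h0 hb
      exact ⟨_, _, .condTrue ((h1 hb).fits hb) h0 hE, hb', hq⟩

/-- The loop rule.  The potential `Φ` pays for every pass through the loop, which gives both
termination and the bound on the running time. -/
theorem wp_loop {b : Expr} {I : State → Prop} {Φ : State → ℕ}
    (hok : ∀ s', Fr P s s' → I s' → b.Ok w s')
    (step : ∀ s', Bdd w s' → Fr P s s' → I s' → b.eval s' ≠ 0 →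
      wp w P s' (fun t s'' => I s'' ∧ t + b.cost + 1 + Φ s'' ≤ Φ s')) (h0 : I s) :
    wp w (.loop b P) s (fun t s' => I s' ∧ b.eval s' = 0 ∧ t ≤ Φ s + b.cost + 1) := by
  suffices H : ∀ N s', Φ s' ≤ N → Fr P s s' → I s' →
      wp w (.loop b P) s' (fun t s'' => I s'' ∧ b.eval s'' = 0 ∧ t ≤ Φ s' + b.cost + 1) from
    H _ s le_rfl (Fr.refl _ _) h0
  intro N
  induction N using Nat.strong_induction_on with
  | _ N ih =>
    intro s' hN hF hI hb
    have hfit := (hok s' hF hI).fits hb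
    by_cases hz : b.eval s' = 0
    · exact ⟨_, _, .loopFalse hfit hz, hb, hI, hz, by omega⟩
    · obtain ⟨t, s1, hE, hb1, hI1, ht⟩ := step s' hb hF hI hz hb
      obtain ⟨t', s2, hE', hb2, hI2, hz2, ht'⟩ :=
        ih (Φ s1) (by omega) s1 le_rfl (hF.trans hE.frame) hI1 hb1
      exact ⟨_, _, .loopTrue hfit hz hE hE', hb2, hI2, hz2, by omega⟩

/-- The loop `while i < h do (P; i := i + 1)` on registers `i` and `h`. -/
def forTo (i h : ℕ) (P : Program) : Program :=
  .loop (.lt (.reg i) (.reg h)) (.seq P (.assign i (.add (.reg i) (.lit 1))))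

/-- The rule for counting loops: `I k` is the invariant before the pass with counter `k`, and `T k`
bounds the time of that pass. -/
theorem wp_forTo {i h : ℕ} (I : ℕ → State → Prop) (T : ℕ → ℕ) (a b : ℕ)
    (hi : P.wr i = false) (hh : P.wr h = false) (hne : h ≠ i)
    (hsi : s.reg i = a) (hsh : s.reg h = b) (hab : a ≤ b) (h0 : I a s)
    (step : ∀ k s', Bdd w s' → Fr (forTo i h P) s s' → a ≤ k → k < b → s'.reg i = k →
      s'.reg h = b → I k s' →
      wp w P s' (fun t s'' => t ≤ T k ∧ I (k + 1) (s''.setReg i (k + 1)))) :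
    wp w (forTo i h P) s (fun t s' => t ≤ ∑ k ∈ Finset.Ico a b, (T k + 8) + 4 ∧
      s'.reg i = b ∧ I b s') := by
  refine wp_bdd fun hb0 => ?_
  have hbw : b < size w := hsh ▸ hb0.reg h
  have hF : ∀ s', Fr (.seq P (.assign i (.add (.reg i) (.lit 1)))) s s' →
      Fr (forTo i h P) s s' := fun s' h => h.mono (fun _ h => h) (fun _ h => h)
  have key := wp_loop (w := w) (P := .seq P (.assign i (.add (.reg i) (.lit 1)))) (s := s)
    (b := .lt (.reg i) (.reg h))
    (I := fun s' => a ≤ s'.reg i ∧ s'.reg i ≤ b ∧ s'.reg h = b ∧ I (s'.reg i) s')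
    (Φ := fun s' => ∑ k ∈ Finset.Ico (s'.reg i) b, (T k + 8))
    (fun _ _ _ => ⟨trivial, trivial⟩) ?_ ⟨hsi.ge, hsi ▸ hab, hsh, hsi ▸ h0⟩
  · refine wp_conseq key fun t s' _ _ ⟨⟨h1, h2, h3, h4⟩, h5, h6⟩ => ?_
    have h7 : s'.reg i = b := by
      simp only [Expr.eval, h3] at h5
      split at h5 <;> omega
    refine ⟨?_, h7, h7 ▸ h4⟩
    simpa [Expr.cost, hsi] using h6
  · rintro s' hb hfr ⟨h1, h2, h3, h4⟩ h5
    have hlt : s'.reg i < b := by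
      simp only [Expr.eval, h3] at h5
      by_contra hc
      simp [hc] at h5
    rw [wp_seq]
    refine wp_conseq (step _ s' hb (hF s' hfr) h1 hlt rfl h3 h4) fun t s'' hfr'' _ ⟨ht, hI⟩ => ?_
    have hi'' : s''.reg i = s'.reg i := hfr''.reg i hi
    have hh'' : s''.reg h = b := (hfr''.reg h hh).trans h3
    rw [wp_assign]
    intro _
    simp only [Expr.Ok, Expr.eval, Expr.cost, setReg_reg, hi'', if_neg hne, if_true, hh'']
    refine ⟨⟨trivial, hb.one_lt, by omega⟩, ⟨by omega, by omega, trivial, hI⟩, ?_⟩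
    rw [← Finset.add_sum_Ioo_eq_sum_Ico hlt]
    have : Finset.Ico (s'.reg i + 1) b = Finset.Ioo (s'.reg i) b := by
      ext; simp
    rw [this]
    omega

end rules

end WordRAM

/-! ### The bucket queue -/

namespace Bucket

/-- Vertex `v` is waiting in bucket `k`.  The entries `0, …, cnt k - 1` of bucket `k` are stored in
`bkt` at the positions congruent to `k` modulo `B`, so that the buckets never collide. -/
def Pend (B : ℕ) (cnt bkt : ℕ → ℕ) (k v : ℕ) : Prop := ∃ i < cnt k, bkt (i * B + k) = v

theorem position_inj {B i i' k k' : ℕ} (hk : k < B) (hk' : k' < B)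
    (h : i * B + k = i' * B + k') : i = i' ∧ k = k' := by
  have h1 : k = k' := by
    have := congrArg (· % B) h
    simpa [Nat.mod_eq_of_lt, hk, hk'] using this
  subst h1
  exact ⟨Nat.eq_of_mul_eq_mul_right (by omega) (Nat.add_right_cancel h), rfl⟩

variable {B : ℕ} {cnt bkt : ℕ → ℕ} {k k' v v' : ℕ}

theorem Pend.push (h : Pend B cnt bkt k' v') (hk : k < B) (hk' : k' < B) (x : ℕ) :
    Pend B (Function.update cnt k (cnt k + 1)) (Function.update bkt (cnt k * B + k) x) k' v' := by
  obtain ⟨i, hi, h⟩ := h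
  refine ⟨i, ?_, ?_⟩
  · rw [Function.update_apply]; split
    · subst_vars; omega
    · exact hi
  · rw [Function.update_of_ne, h]
    intro he
    obtain ⟨h1, rfl⟩ := position_inj hk' hk he
    omega

theorem pend_push_self (x : ℕ) :
    Pend B (Function.update cnt k (cnt k + 1)) (Function.update bkt (cnt k * B + k) x) k x :=
  ⟨cnt k, by simp, by simp⟩

theorem Pend.pop (h : Pend B cnt bkt k' v')
    (hne : ¬ (k' = k ∧ v' = bkt ((cnt k - 1) * B + k))) :
    Pend B (Function.update cnt k (cnt k - 1)) bkt k' v' := by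
  obtain ⟨i, hi, rfl⟩ := h
  refine ⟨i, ?_, rfl⟩
  rw [Function.update_apply]; split
  · subst_vars
    have : i ≠ cnt k' - 1 := fun h => hne ⟨rfl, h ▸ rfl⟩
    omega
  · exact hi

theorem sum_update_add {N : ℕ} (f : ℕ → ℕ) (hk : k < N) (x : ℕ) :
    ∑ i ∈ Finset.range N, Function.update f k x i + f k = ∑ i ∈ Finset.range N, f i + x := by
  have hm := Finset.mem_range.2 hk
  rw [Finset.sum_update_of_mem hm, ← Finset.add_sum_erase _ _ hm, Finset.erase_eq]
  omega

end Bucket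

open Bucket

/-- Adjacency lists of a graph on `0, …, n - 1` as two arrays: the neighbours of `y` are the values
of `fl` on the positions `st y ≤ j < st (y + 1)`. -/
structure Csr (n : ℕ) (st fl : ℕ → ℕ) : Prop where
  pos : 0 < n
  mono : ∀ y < n, st y ≤ st (y + 1)
  le : ∀ y ≤ n, st y ≤ n * n
  fl_lt : ∀ y < n, ∀ j, st y ≤ j → j < st (y + 1) → fl j < n

/-- The cost of scanning the list of `v` if only lists shorter than `lim` are scanned. -/
def scanCost (st : ℕ → ℕ) (lim v : ℕ) : ℕ :=
  if st (v + 1) - st v < lim then st (v + 1) - st v else 0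

/-- The scanning costs of the vertices that are not done yet. -/
def openCost (n : ℕ) (st : ℕ → ℕ) (lim : ℕ) (dn : ℕ → ℕ) : ℕ :=
  ∑ v ∈ Finset.range n, if dn v = 0 then scanCost st lim v else 0

/-- The number of queue entries. -/
def queued (n : ℕ) (cnt : ℕ → ℕ) : ℕ := ∑ k ∈ Finset.range (n + 2), cnt k

/-- The invariant of the bucket queue at level `l`.  The labels `val` started as `val0` and stay
above `g`.  Vertices that are done have relaxed their edges, except that vertex `cur` has done so
only for the positions below `i`; the others wait in the bucket of their label.  Here `cur = n`
means that no list is being scanned.  A vertex may also have entries in buckets of labels that it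
has lost since; `R` bounds the entries present together with those that later scans may add. -/
structure QInv (n : ℕ) (st fl : ℕ → ℕ) (lim : ℕ) (g val0 : ℕ → ℕ) (l cur i R : ℕ)
    (val cnt dn bkt : ℕ → ℕ) : Prop where
  le0 : ∀ v < n, val v ≤ val0 v
  ge : ∀ v < n, g v ≤ val v
  pend : ∀ v < n, dn v = 0 → Pend (n + 2) cnt bkt (val v) v
  ent : ∀ k < n + 2, ∀ i < cnt k, bkt (i * (n + 2) + k) < n
  top : ∀ k, n + 2 ≤ k → cnt k = 0
  low : ∀ k < l, cnt k = 0
  closed : ∀ v < n, dn v ≠ 0 → val v ≤ l ∧ (st (v + 1) - st v < lim →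
    ∀ j, st v ≤ j → j < st (v + 1) → (v = cur → j < i) → val (fl j) ≤ val v + 1)
  cur_val : cur < n → val cur = l
  sum : queued n cnt + openCost n st lim dn ≤ R

section

variable {n : ℕ} {st fl : ℕ → ℕ} {lim : ℕ} {g val0 : ℕ → ℕ} {l cur i R : ℕ}
  {val cnt dn bkt : ℕ → ℕ}

theorem queued_push {k : ℕ} (hk : k < n + 2) :
    queued n (Function.update cnt k (cnt k + 1)) = queued n cnt + 1 := by
  have := sum_update_add cnt hk (cnt k + 1)
  unfold queued; omega

theorem queued_pop {k : ℕ} (hk : k < n + 2) (h0 : cnt k ≠ 0) :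
    queued n (Function.update cnt k (cnt k - 1)) + 1 = queued n cnt := by
  have := sum_update_add cnt hk (cnt k - 1)
  unfold queued; omega

theorem le_queued {k : ℕ} (hk : k < n + 2) : cnt k ≤ queued n cnt :=
  Finset.single_le_sum (f := cnt) (fun _ _ => Nat.zero_le _) (Finset.mem_range.2 hk)

theorem openCost_done {v : ℕ} (hv : v < n) (h0 : dn v = 0) :
    openCost n st lim (Function.update dn v 1) + scanCost st lim v = openCost n st lim dn := by
  unfold openCost
  have h1 : (fun u => if Function.update dn v 1 u = 0 then scanCost st lim u else 0) =
      Function.update (fun u => if dn u = 0 then scanCost st lim u else 0) v 0 := by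
    funext u
    by_cases hu : u = v
    · subst hu; simp
    · simp [hu]
  have := sum_update_add (fun u => if dn u = 0 then scanCost st lim u else 0) hv 0
  simp only [h0, if_true] at this
  simp only [← h1] at this
  omega

theorem scanCost_le {v : ℕ} : scanCost st lim v ≤ st (v + 1) - st v := by
  unfold scanCost; split <;> omega

theorem QInv.nextLevel (h : QInv n st fl lim g val0 l n 0 R val cnt dn bkt) (h0 : cnt l = 0) :
    QInv n st fl lim g val0 (l + 1) n 0 R val cnt dn bkt where
  le0 := h.le0
  ge := h.ge
  pend := h.pend
  ent := h.ent
  top := h.top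
  low k hk := by
    rcases Nat.lt_succ_iff_lt_or_eq.1 hk with hk | rfl
    · exact h.low k hk
    · exact h0
  closed v hv hd := ⟨(h.closed v hv hd).1.trans (Nat.le_succ l), (h.closed v hv hd).2⟩
  cur_val hn := absurd hn (lt_irrefl n)
  sum := h.sum

/-- Removing an entry of a vertex that is done, or whose label has changed since. -/
theorem QInv.popStale (h : QInv n st fl lim g val0 l n 0 R val cnt dn bkt) (hl : l < n + 2)
    (h0 : cnt l ≠ 0)
    (hst : ∀ v, v = bkt ((cnt l - 1) * (n + 2) + l) → dn v = 0 → val v ≠ l) :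
    QInv n st fl lim g val0 l n 0 (queued n cnt + openCost n st lim dn - 1) val
      (Function.update cnt l (cnt l - 1)) dn bkt where
  le0 := h.le0
  ge := h.ge
  pend v hv hd := (h.pend v hv hd).pop fun ⟨h1, h2⟩ => hst v h2 hd h1
  ent k hk i hi := h.ent k hk i (hi.trans_le (by
    rw [Function.update_apply]; split
    · subst_vars; omega
    · rfl))
  top k hk := by
    rw [Function.update_of_ne (by omega)]; exact h.top k hk
  low k hk := by
    rw [Function.update_of_ne (by omega)]; exact h.low k hk
  closed := h.closed
  cur_val := h.cur_val
  sum := by have := queued_pop hl h0; omega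

/-- Removing an entry of a vertex that becomes done now. -/
theorem QInv.popFresh (h : QInv n st fl lim g val0 l n 0 R val cnt dn bkt) (hl : l < n + 2)
    (h0 : cnt l ≠ 0) {v : ℕ} (hv : v = bkt ((cnt l - 1) * (n + 2) + l)) (hd : dn v = 0)
    (hval : val v = l) :
    QInv n st fl lim g val0 l v (st v)
      (queued n cnt + openCost n st lim dn - 1 - scanCost st lim v) val
      (Function.update cnt l (cnt l - 1)) (Function.update dn v 1) bkt where
  le0 := h.le0
  ge := h.ge
  pend u hu hdu := by
    have hne : u ≠ v := by rintro rfl; simp at hdu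
    rw [Function.update_of_ne hne] at hdu
    exact (h.pend u hu hdu).pop fun ⟨_, h2⟩ => hne (h2.trans hv.symm)
  ent k hk i hi := h.ent k hk i (hi.trans_le (by
    rw [Function.update_apply]; split
    · subst_vars; omega
    · rfl))
  top k hk := by
    rw [Function.update_of_ne (by omega)]; exact h.top k hk
  low k hk := by
    rw [Function.update_of_ne (by omega)]; exact h.low k hk
  closed u hu hdu := by
    by_cases hne : u = v
    · subst hne
      exact ⟨hval.le, fun _ j hj _ hj' => absurd (hj' rfl) (by omega)⟩
    · rw [Function.update_of_ne hne] at hdu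
      obtain ⟨h1, h2⟩ := h.closed u hu hdu
      exact ⟨h1, fun hlim j hj hj' _ => h2 hlim j hj hj' (by omega)⟩
  cur_val _ := hval
  sum := by
    have hvn : v < n := hv ▸ h.ent l hl _ (by omega)
    have := queued_pop hl h0
    have := openCost_done (st := st) (lim := lim) hvn hd
    omega

theorem QInv.relaxSkip (h : QInv n st fl lim g val0 l cur i R val cnt dn bkt) (hc : cur < n)
    (hle : val (fl i) ≤ l + 1) :
    QInv n st fl lim g val0 l cur (i + 1) R val cnt dn bkt where
  le0 := h.le0
  ge := h.ge
  pend := h.pend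
  ent := h.ent
  top := h.top
  low := h.low
  closed v hv hd := by
    obtain ⟨h1, h2⟩ := h.closed v hv hd
    refine ⟨h1, fun hlim j hj hj' hcur => ?_⟩
    by_cases hji : v = cur ∧ j = i
    · obtain ⟨rfl, rfl⟩ := hji
      rw [h.cur_val hc]; exact hle
    · exact h2 hlim j hj hj' fun hvc => by
        have := hcur hvc
        have : j ≠ i := fun h => hji ⟨hvc, h⟩
        omega
  cur_val := h.cur_val
  sum := h.sum

/-- Lowering the label of a neighbour of `cur`.  That neighbour is not done, as the labels of those
that are do not exceed `l`, and lowering it keeps the edges into it relaxed. -/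
theorem QInv.relaxPush (h : QInv n st fl lim g val0 l cur i R val cnt dn bkt) (hc : cur < n)
    (hv0 : ∀ v < n, val0 v ≤ n + 1)
    (hg : g (fl i) ≤ g cur + 1) (hfl : fl i < n) (hlt : l + 1 < val (fl i)) :
    QInv n st fl lim g val0 l cur (i + 1) (R + 1) (Function.update val (fl i) (l + 1))
      (Function.update cnt (l + 1) (cnt (l + 1) + 1)) dn
      (Function.update bkt (cnt (l + 1) * (n + 2) + (l + 1)) (fl i)) := by
  have hl : l + 1 < n + 2 := by
    have := h.le0 _ hfl
    have := hv0 _ hfl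
    omega
  have hup : ∀ v, Function.update val (fl i) (l + 1) v ≤ val v := fun v => by
    rw [Function.update_apply]; split
    · subst_vars; omega
    · rfl
  constructor
  · exact fun v hv => (hup v).trans (h.le0 v hv)
  · intro v hv
    rw [Function.update_apply]; split
    · subst_vars
      have := h.ge cur hc
      have := h.cur_val hc
      omega
    · exact h.ge v hv
  · intro v hv hd
    by_cases hvx : v = fl i
    · subst hvx
      simpa using pend_push_self (fl i)
    · rw [Function.update_of_ne hvx]
      refine (h.pend v hv hd).push hl ?_ _
      have := h.le0 v hv
      have := hv0 v hv
      omega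
  · intro k hk i' hi'
    rw [Function.update_apply]; split
    · exact hfl
    · rename_i hne
      refine h.ent k hk i' ?_
      rw [Function.update_apply] at hi'
      split at hi'
      · subst_vars
        have : i' ≠ cnt (l + 1) := fun h => hne (by rw [h])
        omega
      · exact hi'
  · intro k hk
    rw [Function.update_of_ne (by omega)]; exact h.top k hk
  · intro k hk
    rw [Function.update_of_ne (by omega)]; exact h.low k hk
  · intro v hv hd
    obtain ⟨h1, h2⟩ := h.closed v hv hd
    have hvx : v ≠ fl i := by rintro rfl; omega
    rw [Function.update_of_ne hvx]
    refine ⟨h1, fun hlim j hj hj' hcur => ?_⟩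
    by_cases hji : v = cur ∧ j = i
    · obtain ⟨rfl, rfl⟩ := hji
      rw [h.cur_val hc]; simp
    · exact (hup _).trans (h2 hlim j hj hj' fun hvc => by
        have := hcur hvc
        have : j ≠ i := fun h => hji ⟨hvc, h⟩
        omega)
  · intro _
    rw [Function.update_of_ne]
    · exact h.cur_val hc
    · intro he
      have := h.cur_val hc
      rw [he] at this; omega
  · rw [queued_push hl]
    have := h.sum
    omega

/-- Once the list of `cur` has been scanned, or is too long to be scanned, `cur` is as good as any
other vertex that is done. -/
theorem QInv.finish (h : QInv n st fl lim g val0 l cur i R val cnt dn bkt)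
    (hi : st (cur + 1) - st cur < lim → st (cur + 1) ≤ i) :
    QInv n st fl lim g val0 l n 0 R val cnt dn bkt where
  le0 := h.le0
  ge := h.ge
  pend := h.pend
  ent := h.ent
  top := h.top
  low := h.low
  closed v hv hd := by
    obtain ⟨h1, h2⟩ := h.closed v hv hd
    refine ⟨h1, fun hlim j hj hj' _ => h2 hlim j hj hj' fun hvc => ?_⟩
    subst hvc
    have := hi hlim
    omega
  cur_val hn := absurd hn (lt_irrefl n)
  sum := h.sum

theorem QInv.mono {R' : ℕ} (h : QInv n st fl lim g val0 l cur i R val cnt dn bkt) (hR : R ≤ R') :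
    QInv n st fl lim g val0 l cur i R' val cnt dn bkt :=
  { h with sum := h.sum.trans hR }

/-- When all levels have been processed, every vertex is done. -/
theorem QInv.done (h : QInv n st fl lim g val0 l n 0 R val cnt dn bkt)
    (hv0 : ∀ v < n, val0 v ≤ n + 1) (hl : n + 2 ≤ l) {v : ℕ} (hv : v < n) : dn v ≠ 0 := by
  intro hd
  obtain ⟨i, hi, -⟩ := h.pend v hv hd
  have := h.le0 v hv
  have := hv0 v hv
  rw [h.low _ (by omega)] at hi
  omega

end

namespace WordRAM

open WordRAM.Expr WordRAM.Program

infixr:60 " ;; " => Program.seq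
infix:62 " ≔ " => Program.assign
infixl:65 " +ₑ " => Expr.add
infixl:65 " -ₑ " => Expr.sub
infixl:70 " *ₑ " => Expr.mul

/-! The numbers of the registers and of the arrays of the program, by name.  The input occupies
`r_n`, `a_st` and `a_fl`, and the output appears in `r_n`. -/

notation "r_n" => 0
notation "r_s" => 1
notation "r_E" => 2
notation "r_bc" => 3
notation "r_best" => 4
notation "r_u" => 5
notation "r_j" => 6
notation "r_h" => 7
notation "r_c" => 8
notation "r_x" => 9
notation "r_B" => 10
notation "r_l" => 11
notation "r_lim" => 12
notation "r_v" => 13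
notation "r_i" => 14
notation "r_k" => 15
notation "r_y" => 16

notation "a_st" => 0
notation "a_fl" => 1
notation "a_val" => 2
notation "a_cnt" => 3
notation "a_dn" => 4
notation "a_bkt" => 5
notation "a_dom" => 6
notation "a_T" => 7
notation "a_M" => 8

/-- The state holds the number of vertices and the adjacency lists. -/
structure Loaded (n : ℕ) (st fl : ℕ → ℕ) (s : State) : Prop where
  n : s.reg r_n = n
  st : s.arr a_st = st
  fl : s.arr a_fl = fl

theorem Loaded.of_frame {n : ℕ} {st fl : ℕ → ℕ} {s s' : State} {P : Program}
    (h : Loaded n st fl s) (hf : Fr P s s') (hn : P.wr r_n = false) (hst : P.wa a_st = false)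
    (hfl : P.wa a_fl = false) : Loaded n st fl s' :=
  ⟨(hf.reg _ hn).trans h.n, (hf.arr _ hst).trans h.st, (hf.arr _ hfl).trans h.fl⟩

/-! ### The shortest path routine -/

/-- Append `x` to bucket `k`. -/
def push (k x : Expr) : Program :=
  .store a_bkt (cell a_cnt k *ₑ reg r_B +ₑ k) x ;; .store a_cnt k (cell a_cnt k +ₑ lit 1)

/-- Relax the edge at position `r_i`, from a vertex with label `r_l`. -/
def relaxEdge : Program :=
  r_y ≔ cell a_fl (reg r_i) ;;
  cond (lt (reg r_l +ₑ lit 1) (cell a_val (reg r_y)))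
    (.store a_val (reg r_y) (reg r_l +ₑ lit 1) ;; push (reg r_l +ₑ lit 1) (reg r_y))
    skip

/-- Take an entry from bucket `r_l`; if it is current and its vertex has a list shorter than
`r_lim`, relax the edges of that list. -/
def popEntry : Program :=
  .store a_cnt (reg r_l) (cell a_cnt (reg r_l) -ₑ lit 1) ;;
  r_v ≔ cell a_bkt (cell a_cnt (reg r_l) *ₑ reg r_B +ₑ reg r_l) ;;
  cond (eq (cell a_dn (reg r_v)) (lit 0))
    (cond (eq (cell a_val (reg r_v)) (reg r_l))
      (.store a_dn (reg r_v) (lit 1) ;;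
       r_i ≔ cell a_st (reg r_v) ;;
       r_k ≔ cell a_st (reg r_v +ₑ lit 1) ;;
       cond (lt (reg r_k -ₑ reg r_i) (reg r_lim)) (forTo r_i r_k relaxEdge) skip)
      skip)
    skip

/-- Put every vertex into the bucket of its label. -/
def initQueue : Program :=
  r_B ≔ reg r_n +ₑ lit 2 ;;
  r_v ≔ lit 0 ;;
  forTo r_v r_n (.store a_dn (reg r_v) (lit 0) ;; push (cell a_val (reg r_v)) (reg r_v))

/-- Process the buckets in increasing order. -/
def drainQueue : Program :=
  r_l ≔ lit 0 ;;
  loop (lt (reg r_l) (reg r_B)) (cond (cell a_cnt (reg r_l)) popEntry (r_l ≔ reg r_l +ₑ lit 1))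

/-- Lower the labels in `a_val` until no edge out of a vertex with fewer than `r_lim` neighbours
can be relaxed any more. -/
def lowerLabels : Program := initQueue ;; drainQueue

/-- `QInv` for the arrays of a state. -/
def QState (n : ℕ) (st fl : ℕ → ℕ) (lim : ℕ) (g val0 : ℕ → ℕ) (l cur i R : ℕ) (s : State) : Prop :=
  QInv n st fl lim g val0 l cur i R (s.arr a_val) (s.arr a_cnt) (s.arr a_dn) (s.arr a_bkt)

section

variable {w n : ℕ} {st fl : ℕ → ℕ} {lim : ℕ} {g val0 : ℕ → ℕ} {l cur i R : ℕ} {s : State}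

/-- The address arithmetic of the queue stays within words. -/
theorem bucket_addr_lt (hW : (n + 2) ^ 4 < size w) {c k : ℕ} (hc : c ≤ n + n * n) (hk : k < n + 2) :
    c * (n + 2) + k < size w := by
  nlinarith [Nat.mul_le_mul_right (n + 2) hc, sq_nonneg n]

theorem wp_relaxEdge (hC : Csr n st fl) (hW : (n + 2) ^ 4 < size w) (hv0 : ∀ v < n, val0 v ≤ n + 1)
    (hL : Loaded n st fl s) (hB : s.reg r_B = n + 2) (hl : s.reg r_l = l) (hi : s.reg r_i = i)
    (hc : cur < n) (hi1 : st cur ≤ i) (hi2 : i < st (cur + 1)) (hR : R ≤ n + n * n)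
    (hg : g (fl i) ≤ g cur + 1) (h : QState n st fl lim g val0 l cur i R s) :
    wp w relaxEdge s (fun t s' => t ≤ 40 ∧ QState n st fl lim g val0 l cur (i + 1) (R + 1) s') := by
  have hfl := hC.fl_lt cur hc i hi1 hi2
  have hW' : n + 2 < size w := by nlinarith [sq_nonneg n]
  have hlv : l ≤ n + 1 := (h.cur_val hc) ▸ (h.le0 _ hc).trans (hv0 _ hc)
  unfold relaxEdge push
  simp [hL.fl, hB, hl, hi]
  intro hb
  refine ⟨fun _ => by omega, fun hlt _ => ⟨by omega, fun _ => ?_⟩, fun hle _ => ?_⟩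
  · have hln : l + 1 < n + 2 := by
      have := (h.le0 _ hfl).trans (hv0 _ hfl)
      omega
    have hcnt : s.arr a_cnt (l + 1) ≤ n + n * n :=
      (le_queued hln).trans (((Nat.le_add_right _ _).trans h.sum).trans hR)
    have := bucket_addr_lt hW hcnt hln
    have h1 : s.arr a_cnt (l + 1) * (n + 2) < size w := by omega
    have h2 : s.arr a_cnt (l + 1) + 1 < size w := by nlinarith
    have hQ := h.relaxPush hc hv0 hg hfl hlt
    refine ⟨⟨⟨⟨by omega, by omega⟩, h1⟩, ⟨by omega, by omega⟩, this⟩,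
      fun _ => ⟨⟨by omega, by omega⟩, ⟨⟨by omega, by omega⟩, by omega, h2⟩, ?_⟩⟩
    simpa [QState] using hQ
  · exact (h.relaxSkip hc hle).mono (Nat.le_succ R)

/-- A potential that bounds the time the queue still needs: it pays for every entry present, for
every edge that is still to be scanned and the entry this may add, and for every level. -/
def queuePot (n : ℕ) (st : ℕ → ℕ) (lim : ℕ) (s : State) : ℕ :=
  100 * (queued n (s.arr a_cnt) + openCost n st lim (s.arr a_dn)) +
    100 * openCost n st lim (s.arr a_dn) + 20 * (n + 2 - s.reg r_l)

theorem wp_popEntry (hC : Csr n st fl) (hW : (n + 2) ^ 4 < size w) (hv0 : ∀ v < n, val0 v ≤ n + 1)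
    (hL : Loaded n st fl s) (hB : s.reg r_B = n + 2) (hl : s.reg r_l = l)
    (hlim : s.reg r_lim = lim) (hln : l < n + 2) (h0 : s.arr a_cnt l ≠ 0)
    (hg : ∀ v < n, ∀ j, st v ≤ j → j < st (v + 1) → g (fl j) ≤ g v + 1) (hR : R ≤ n + n * n)
    (h : QState n st fl lim g val0 l n 0 R s) :
    wp w popEntry s (fun t s' => QState n st fl lim g val0 l n 0 R s' ∧
      t + 8 + queuePot n st lim s' ≤ queuePot n st lim s) := by
  have hcnt : s.arr a_cnt l ≤ n + n * n :=
    (le_queued hln).trans (((Nat.le_add_right _ _).trans h.sum).trans hR)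
  have haddr := bucket_addr_lt hW (c := s.arr a_cnt l - 1) (by omega) hln
  have h1 : (s.arr a_cnt l - 1) * (n + 2) < size w := by omega
  have hW' : n + 2 < size w := by nlinarith [sq_nonneg n]
  have hpop := queued_pop hln h0
  set v := s.arr a_bkt ((s.arr a_cnt l - 1) * (n + 2) + l) with hv
  have hvn : v < n := h.ent l hln _ (by omega)
  have hs := h.sum
  unfold popEntry
  simp [hL.st, hB, hl, hlim, ← hv]
  intro hb
  refine ⟨by omega, fun _ => ⟨⟨h1, haddr⟩, fun _ => by omega, fun hd => ⟨?_, ?_⟩,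
    fun hd _ => ⟨?_, ?_⟩⟩⟩
  · intro hval _
    have hQ := h.popFresh hln h0 hv hd hval
    have hdone := openCost_done (st := st) (lim := lim) hvn hd
    refine ⟨by omega, fun _ _ => ⟨by omega, ?_, fun hlong _ => ⟨?_, ?_⟩⟩⟩
    · intro hshort
      have hsc : scanCost st lim v = st (v + 1) - st v := if_pos hshort
      have hmono := hC.mono v hvn
      refine wp_conseq (wp_forTo
        (I := fun j s' => QState n st fl lim g val0 l v j
          (queued n (s.arr a_cnt) + openCost n st lim (s.arr a_dn) - 1 - scanCost st lim v +
            (j - st v)) s')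
        (T := fun _ => 40) (a := st v) (b := st (v + 1)) rfl rfl (by decide) (by simp)
        (by simp) hmono ?_ ?_) ?_
      · simpa [QState] using hQ
      · intro k s' hb' hfr hk1 hk2 hik hkk hI
        have hsc' := scanCost_le (st := st) (lim := lim) (v := v)
        refine wp_conseq (wp_relaxEdge hC hW hv0 ⟨?_, ?_, ?_⟩ ?_ ?_ hik hvn hk1 hk2 ?_
          (hg v hvn k hk1 hk2) hI) ?_
        · rw [hfr.reg _ rfl]; simp [hL.n]
        · rw [hfr.arr _ rfl]; simp [hL.st]
        · rw [hfr.arr _ rfl]; simp [hL.fl]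
        · rw [hfr.reg _ rfl]; simp [hB]
        · rw [hfr.reg _ rfl]; simp [hl]
        · omega
        · rintro t s'' _ _ ⟨ht, hQ'⟩
          refine ⟨ht, ?_⟩
          have : k - st v + 1 = k + 1 - st v := by omega
          rw [add_assoc, this] at hQ'
          simpa [QState] using hQ'
      · rintro t s' hfr - ⟨ht, -, hI⟩
        simp at ht
        have hI' := hI.finish (fun _ => le_rfl)
        have e1 : s'.arr a_dn = Function.update (s.arr a_dn) v 1 := by
          rw [hfr.arr _ rfl]; simp
        have e2 : s'.reg r_l = l := by rw [hfr.reg _ rfl]; simp [hl]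
        have hsum := hI'.sum
        rw [e1] at hsum
        refine ⟨hI'.mono (by omega), ?_⟩
        simp only [queuePot, e1, e2, hl]
        omega
    · have hQ' := hQ.finish (fun h => absurd h (by omega))
      simpa [QState] using hQ'.mono (by omega)
    · simp [queuePot, hl]
      omega
  · intro hval _
    have hQ := h.popStale hln h0 (fun u hu _ => by rw [hu, ← hv]; exact hval)
    refine ⟨by simpa [QState] using hQ.mono (by omega), ?_⟩
    simp [queuePot, hl]
    omega
  · have hQ := h.popStale hln h0 (fun u hu hdu => absurd hdu (by rw [hu, ← hv]; exact hd))
    simpa [QState] using hQ.mono (by omega)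
  · simp [queuePot, hl]
    omega

theorem openCost_le {dn : ℕ → ℕ} :
    openCost n st lim dn ≤ ∑ v ∈ Finset.range n, scanCost st lim v :=
  Finset.sum_le_sum fun v _ => by split <;> omega

theorem sum_scanCost_le (hC : Csr n st fl) :
    ∑ v ∈ Finset.range n, scanCost st lim v ≤ st n - st 0 := by
  have key : ∀ m ≤ n, ∑ v ∈ Finset.range m, scanCost st lim v + st 0 ≤ st m := by
    intro m
    induction m with
    | zero => simp
    | succ m ih =>
      intro hm
      rw [Finset.sum_range_succ]
      have := ih (by omega)
      have := scanCost_le (st := st) (lim := lim) (v := m)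
      have := hC.mono m (by omega)
      omega
  have := key n le_rfl
  omega

/-- The state of the queue after the vertices below `k` have been inserted. -/
structure QInit (n : ℕ) (val0 : ℕ → ℕ) (k : ℕ) (s : State) : Prop where
  val : s.arr a_val = val0
  pend : ∀ v < k, s.arr a_dn v = 0 ∧ Pend (n + 2) (s.arr a_cnt) (s.arr a_bkt) (val0 v) v
  ent : ∀ k < n + 2, ∀ i < s.arr a_cnt k, s.arr a_bkt (i * (n + 2) + k) < n
  top : ∀ k, n + 2 ≤ k → s.arr a_cnt k = 0
  sum : queued n (s.arr a_cnt) = k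

theorem QInit.queue (h : QInit n val0 n s) (hg : ∀ v < n, g v ≤ val0 v) :
    QState n st fl lim g val0 0 n 0 (n + ∑ v ∈ Finset.range n, scanCost st lim v) s where
  le0 v _ := by rw [h.val]
  ge v hv := by rw [h.val]; exact hg v hv
  pend v hv _ := by rw [h.val]; exact (h.pend v hv).2
  ent := h.ent
  top := h.top
  low k hk := absurd hk (Nat.not_lt_zero k)
  closed v hv hd := absurd (h.pend v hv).1 hd
  cur_val hn := absurd hn (lt_irrefl n)
  sum := by
    rw [h.sum]
    exact Nat.add_le_add_left openCost_le n

theorem wp_initQueue (hW : (n + 2) ^ 4 < size w)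
    (hL : Loaded n st fl s) (hv0 : ∀ v < n, s.arr a_val v ≤ n + 1) (hcnt : ∀ k, s.arr a_cnt k = 0) :
    wp w initQueue s (fun t s' => t ≤ 40 * n + 20 ∧ s'.reg r_B = n + 2 ∧
      QInit n (s.arr a_val) n s') := by
  have hW' : n + 2 < size w := by nlinarith [sq_nonneg n]
  unfold initQueue
  simp [hL.n]
  refine fun hb => ⟨⟨by omega, hW'⟩, fun _ => ⟨by omega, ?_⟩⟩
  refine wp_conseq (wp_forTo (I := fun k s' => QInit n (s.arr a_val) k s') (T := fun _ => 30)
    (a := 0) (b := n) rfl rfl (by decide) (by simp) (by simp [hL.n]) (Nat.zero_le n) ?_ ?_) ?_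
  · exact ⟨rfl, by simp, by simp [hcnt], by simp [hcnt], by simp [queued, hcnt]⟩
  · intro k s' hb' hfr _ hk hk' _ hI
    have eB : s'.reg r_B = n + 2 := by rw [hfr.reg _ rfl]; simp
    have hkn : s.arr a_val k < n + 2 := by have := hv0 k hk; omega
    have hcl : s'.arr a_cnt (s.arr a_val k) ≤ n := by
      have := le_queued (cnt := s'.arr a_cnt) hkn
      rw [hI.sum] at this; omega
    have haddr := bucket_addr_lt hW (c := s'.arr a_cnt (s.arr a_val k)) (by nlinarith) hkn
    simp [push, hk', eB, hI.val]
    refine fun _ => ⟨by omega, fun _ => ⟨⟨by omega, haddr⟩, fun _ => ⟨⟨by omega, by omega⟩, ?_⟩⟩⟩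
    constructor
    · simp [hI.val]
    · intro v hv
      simp
      by_cases hvk : v = k
      · subst hvk
        exact ⟨by simp, pend_push_self v⟩
      · have hv' : v < k := by omega
        refine ⟨by simp [hvk, (hI.pend v hv').1], (hI.pend v hv').2.push hkn ?_ k⟩
        have := hv0 v (by omega); omega
    · intro k' hk' i hi
      simp [Function.update_apply] at hi ⊢
      split
      · exact hk
      · rename_i hne
        refine hI.ent k' hk' i ?_
        split at hi
        · rename_i hkk; subst hkk
          have : i ≠ s'.arr a_cnt (s.arr a_val k) := fun h => hne (by rw [h])
          omega
        · exact hi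
    · intro k' hk'
      simp
      rw [Function.update_of_ne (by omega)]; exact hI.top k' hk'
    · simp
      rw [queued_push hkn, hI.sum]
  · rintro t s' hfr - ⟨ht, -, hI⟩
    simp at ht
    refine ⟨by omega, ?_, hI⟩
    rw [hfr.reg _ rfl]; simp

/-- The effect of `lowerLabels`: labels only decrease, they stay above every function `g` that
grows by at most one along an edge, and no edge out of a scanned vertex can be relaxed.  The bucket
counters are zero before and after, so that the routine can be run again. -/
theorem wp_lowerLabels (hC : Csr n st fl) (hW : (n + 2) ^ 4 < size w) (hL : Loaded n st fl s)
    (hlim : s.reg r_lim = lim) (hv0 : ∀ v < n, s.arr a_val v ≤ n + 1)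
    (hcnt : ∀ k, s.arr a_cnt k = 0) (hg0 : ∀ v < n, g v ≤ s.arr a_val v)
    (hg : ∀ v < n, ∀ j, st v ≤ j → j < st (v + 1) → g (fl j) ≤ g v + 1) :
    wp w lowerLabels s (fun t s' =>
      t ≤ 300 * (n + 1 + ∑ v ∈ Finset.range n, scanCost st lim v) ∧
      (∀ k, s'.arr a_cnt k = 0) ∧ (∀ v < n, s'.arr a_val v ≤ s.arr a_val v) ∧
      (∀ v < n, g v ≤ s'.arr a_val v) ∧
      ∀ v < n, st (v + 1) - st v < lim → ∀ j, st v ≤ j → j < st (v + 1) →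
        s'.arr a_val (fl j) ≤ s'.arr a_val v + 1) := by
  set R := n + ∑ v ∈ Finset.range n, scanCost st lim v with hRdef
  have hW' : n + 2 < size w := by nlinarith [sq_nonneg n]
  have hR : R ≤ n + n * n := by
    have := sum_scanCost_le (lim := lim) hC
    have := hC.le n le_rfl
    omega
  unfold lowerLabels drainQueue
  simp only [wp_seq]
  refine wp_conseq (wp_initQueue hW hL hv0 hcnt) fun t s1 hfr1 _ ⟨ht1, hB1, hI1⟩ => ?_
  simp only [wp_assign]
  refine fun _ => ⟨by simp; omega, ?_⟩
  have hL1 : Loaded n st fl s1 := hL.of_frame hfr1 rfl rfl rfl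
  have hlim1 : s1.reg r_lim = lim := (hfr1.reg _ rfl).trans hlim
  refine wp_conseq (wp_loop (Φ := queuePot n st lim)
    (I := fun s' => s'.reg r_l ≤ n + 2 ∧ QState n st fl lim g (s.arr a_val) (s'.reg r_l) n 0 R s')
    ?_ ?_ ?_) ?_
  · intros; simp
  · rintro s' hb' hfr ⟨hle, hQ⟩ hguard
    have hL' : Loaded n st fl s' := by
      refine ⟨?_, ?_, ?_⟩
      · rw [hfr.reg _ rfl]; simp [hL1.n]
      · rw [hfr.arr _ rfl]; simp [hL1.st]
      · rw [hfr.arr _ rfl]; simp [hL1.fl]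
    have hB' : s'.reg r_B = n + 2 := by rw [hfr.reg _ rfl]; simp [hB1]
    have hlim' : s'.reg r_lim = lim := by rw [hfr.reg _ rfl]; simp [hlim1]
    have hlt : s'.reg r_l < n + 2 := by
      by_contra hc
      simp [hB', hc] at hguard
    rw [wp_cond]
    refine ⟨by simp, fun h0 => ?_, fun h0 => ?_⟩
    · refine wp_conseq (wp_popEntry hC hW hv0 hL' hB' rfl hlim' hlt h0 hg hR hQ)
        fun t s2 hfr2 _ ⟨hQ2, ht2⟩ => ?_
      have e : s2.reg r_l = s'.reg r_l := hfr2.reg _ rfl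
      simp only [Expr.cost, e]
      exact ⟨⟨hle, hQ2⟩, by omega⟩
    · have hQ2 := hQ.nextLevel h0
      simp
      refine fun _ => ⟨by omega, ⟨by omega, by simpa [QState] using hQ2⟩, ?_⟩
      simp [queuePot]
      omega
  · simp
    exact hI1.queue hg0
  · rintro t' s' hfr - ⟨⟨hle, hQ⟩, hguard, ht'⟩
    have hB' : s'.reg r_B = n + 2 := by rw [hfr.reg _ rfl]; simp [hB1]
    have hl' : n + 2 ≤ s'.reg r_l := by
      by_contra hc
      simp [hB', hc] at hguard
    refine ⟨?_, fun k => ?_, hQ.le0, hQ.ge, fun v hv hlimv j hj hj' => ?_⟩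
    · have h1 : openCost n st lim (s1.arr a_dn) ≤ R :=
        openCost_le.trans (Nat.le_add_left _ _)
      have h2 := hI1.sum
      have h3 := openCost_le (n := n) (st := st) (lim := lim) (dn := s1.arr a_dn)
      simp [queuePot, h2] at ht' ⊢
      omega
    · by_cases hk : k < s'.reg r_l
      · exact hQ.low k hk
      · exact hQ.top k (by omega)
    · exact (hQ.closed v hv (hQ.done hv0 hl' hv)).2 hlimv j hj hj' (by omega)

end
end WordRAM

/-! ### Breadth-first search and the greedy dominating set -/

/-- The adjacency lists `st`, `fl` of a connected graph with distance function `d` and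
diameter `D`, all on `0, …, n - 1`. -/
structure Net (n : ℕ) (st fl : ℕ → ℕ) (d : ℕ → ℕ → ℕ) (D : ℕ) : Prop extends Csr n st fl where
  deg_lt : ∀ y < n, st (y + 1) - st y < n
  nodup : ∀ y < n, ∀ j, st y ≤ j → j < st (y + 1) → ∀ j', st y ≤ j' → j' < st (y + 1) →
    fl j = fl j' → j = j'
  symm : ∀ y < n, ∀ j, st y ≤ j → j < st (y + 1) →
    ∃ j', st (fl j) ≤ j' ∧ j' < st (fl j + 1) ∧ fl j' = y
  dist_self : ∀ u < n, d u u = 0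
  dist_comm : ∀ u v, d u v = d v u
  dist_lt : ∀ u < n, ∀ v < n, d u v < n
  eq_of_dist : ∀ u < n, ∀ v < n, d u v = 0 → u = v
  dist_step : ∀ u < n, ∀ y < n, ∀ j, st y ≤ j → j < st (y + 1) → d u (fl j) ≤ d u y + 1
  dist_pred : ∀ u < n, ∀ v < n, d u v ≠ 0 →
    ∃ y < n, ∃ j, st y ≤ j ∧ j < st (y + 1) ∧ fl j = v ∧ d u v = d u y + 1
  triangle : ∀ u < n, ∀ v < n, ∀ x < n, d u v ≤ d u x + d x v
  le_diam : ∀ u < n, ∀ v < n, d u v ≤ D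
  diam_attained : ∃ u < n, ∃ v < n, d u v = D

theorem Csr.sum_deg_le {n : ℕ} {st fl : ℕ → ℕ} (hC : Csr n st fl) :
    ∑ v ∈ Finset.range n, (st (v + 1) - st v) ≤ st n := by
  have key : ∀ m ≤ n, ∑ v ∈ Finset.range m, (st (v + 1) - st v) ≤ st m := by
    intro m
    induction m with
    | zero => simp
    | succ m ih =>
      intro hm
      rw [Finset.sum_range_succ]
      have := ih (by omega)
      have := hC.mono m (by omega)
      omega
  exact key n le_rfl

theorem Csr.sum_time_le {n : ℕ} {st fl : ℕ → ℕ} (hC : Csr n st fl) (A B : ℕ) :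
    ∑ v ∈ Finset.Ico 0 n, (A + B * (st (v + 1) - st v) + 8) ≤ (A + 8) * n + B * st n := by
  rw [← Finset.range_eq_Ico]
  have h1 : ∑ v ∈ Finset.range n, (A + B * (st (v + 1) - st v) + 8) =
      (A + 8) * n + B * ∑ v ∈ Finset.range n, (st (v + 1) - st v) := by
    rw [Finset.mul_sum]
    simp only [Finset.sum_add_distrib, Finset.sum_const, Finset.card_range, smul_eq_mul]
    ring
  rw [h1]
  exact Nat.add_le_add_left (Nat.mul_le_mul_left B hC.sum_deg_le) _

theorem Csr.start_le {n : ℕ} {st fl : ℕ → ℕ} (hC : Csr n st fl) {y : ℕ} (hy : y ≤ n) :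
    st y ≤ st n := by
  have key : ∀ k, y + k ≤ n → st y ≤ st (y + k) := by
    intro k
    induction k with
    | zero => simp
    | succ k ih =>
      intro hk
      exact (ih (by omega)).trans (hC.mono (y + k) (by omega))
  have := key (n - y) (by omega)
  rwa [Nat.add_sub_cancel' hy] at this

theorem index_lt {n u x : ℕ} (hu : u < n) (hx : x < n) : u * n + x < n * n := by nlinarith

theorem index_inj {n u x u' x' : ℕ} (hx : x < n) (hx' : x' < n) (h : u * n + x = u' * n + x') :
    u = u' ∧ x = x' := position_inj hx hx' h

/-- The vertices of degree at least `S` without a dominator. -/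
def needy (n : ℕ) (st : ℕ → ℕ) (S : ℕ) (dom : ℕ → ℕ) : Finset ℕ :=
  {x ∈ Finset.range n | dom x = 0 ∧ S ≤ st (x + 1) - st x}

/-- The number of neighbours of `y` in `U`. -/
def hits (st fl : ℕ → ℕ) (U : Finset ℕ) (y : ℕ) : ℕ :=
  {j ∈ Finset.Ico (st y) (st (y + 1)) | fl j ∈ U}.card

namespace WordRAM

open WordRAM.Expr WordRAM.Program

/-- The length of the list of the vertex with number `e`. -/
def degE (e : Expr) : Expr := cell a_st (e +ₑ lit 1) -ₑ cell a_st e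

/-- Compute the distances from vertex `r_best`.  As degrees are less than `r_n`, no list is left
out. -/
def bfs : Program :=
  r_c ≔ lit 0 ;;
  forTo r_c r_n (.store a_val (reg r_c) (reg r_n)) ;;
  .store a_val (reg r_best) (lit 0) ;;
  r_lim ≔ reg r_n ;;
  lowerLabels

/-- Save the distances from vertex `r_best` in row `r_best` of `a_T`, and raise `r_E` to their
maximum. -/
def recordRow : Program :=
  r_c ≔ lit 0 ;;
  forTo r_c r_n
    (.store a_T (reg r_best *ₑ reg r_n +ₑ reg r_c) (cell a_val (reg r_c)) ;;
     cond (lt (reg r_E) (cell a_val (reg r_c))) (r_E ≔ cell a_val (reg r_c)) skip)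

/-- Let `r_best` be the dominator of its neighbours that have none yet; the dominator `b` is stored
as `b + 1`. -/
def markRow : Program :=
  r_j ≔ cell a_st (reg r_best) ;;
  r_h ≔ cell a_st (reg r_best +ₑ lit 1) ;;
  forTo r_j r_h
    (r_x ≔ cell a_fl (reg r_j) ;;
     cond (eq (cell a_dom (reg r_x)) (lit 0)) (.store a_dom (reg r_x) (reg r_best +ₑ lit 1)) skip)

/-- Count the neighbours of `r_u` of degree at least `r_s` that have no dominator. -/
def countRow : Program :=
  r_c ≔ lit 0 ;;
  r_j ≔ cell a_st (reg r_u) ;;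
  r_h ≔ cell a_st (reg r_u +ₑ lit 1) ;;
  forTo r_j r_h
    (r_x ≔ cell a_fl (reg r_j) ;;
     cond (eq (cell a_dom (reg r_x)) (lit 0))
      (cond (lt (degE (reg r_x)) (reg r_s)) skip (r_c ≔ reg r_c +ₑ lit 1)) skip)

/-- Find the vertex `r_best` with the most such neighbours, `r_bc` in number. -/
def findBest : Program :=
  r_bc ≔ lit 0 ;;
  r_best ≔ lit 0 ;;
  r_u ≔ lit 0 ;;
  forTo r_u r_n
    (countRow ;; cond (lt (reg r_bc) (reg r_c)) (r_bc ≔ reg r_c ;; r_best ≔ reg r_u) skip)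

section

variable {w n : ℕ} {st fl : ℕ → ℕ} {d : ℕ → ℕ → ℕ} {D : ℕ} {s : State}

theorem lt_size_of_le (hW : (n + 2) ^ 4 < size w) {k : ℕ} (hk : k ≤ n * n + n + 2) :
    k < size w := by
  nlinarith [sq_nonneg n]

/-- Breadth-first search is the case of `lowerLabels` in which the lower bound `g` is the distance
itself. -/
theorem wp_bfs (hN : Net n st fl d D) (hW : (n + 2) ^ 4 < size w) (hL : Loaded n st fl s)
    {b : ℕ} (hbn : b < n) (hb : s.reg r_best = b) (hcnt : ∀ k, s.arr a_cnt k = 0) :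
    wp w bfs s (fun t s' => t ≤ 400 * (n + 1 + st n) ∧ (∀ k, s'.arr a_cnt k = 0) ∧
      ∀ v < n, s'.arr a_val v = d b v) := by
  unfold bfs
  simp
  refine fun hb0 => ⟨lt_size_of_le hW (by omega), ?_⟩
  refine wp_conseq (wp_forTo (I := fun k s' => ∀ v < k, s'.arr a_val v = n) (T := fun _ => 3)
    (a := 0) (b := n) rfl rfl (by decide) (by simp) (by simp [hL.n]) (Nat.zero_le n) ?_ ?_) ?_
  · simp
  · intro k s' _ hfr _ hk hik hn hI
    simp [hik, hn]
    intro _ v hv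
    by_cases hvk : v = k
    · simp [hvk]
    · simp [hvk, hI v (by omega)]
  · rintro t s1 hfr _ ⟨ht, -, hI⟩
    have e1 : s1.reg r_best = b := by rw [hfr.reg _ rfl]; simp [hb]
    have hL1 : Loaded n st fl s1 :=
      Loaded.of_frame (s := s.setReg r_c 0) ⟨by simp [hL.n], by simp [hL.st], by simp [hL.fl]⟩
        hfr rfl rfl rfl
    have hcnt1 : ∀ k, s1.arr a_cnt k = 0 := by rw [hfr.arr _ rfl]; simpa using hcnt
    simp [e1, hL1.n]
    refine fun _ => ⟨lt_size_of_le hW (by omega), fun _ => ?_⟩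
    refine wp_conseq (wp_lowerLabels (lim := n) (g := d b) hN.toCsr hW
      ⟨by simp [hL1.n], by simp [hL1.st], by simp [hL1.fl]⟩ (by simp) ?_ (by simpa using hcnt1)
      ?_ ?_) ?_
    · intro v hv
      by_cases hvb : v = b
      · simp [hvb]
      · simp [hvb, hI v hv]
    · intro v hv
      by_cases hvb : v = b
      · simp [hvb, hN.dist_self b hbn]
      · simp [hvb, hI v hv]
        exact (hN.dist_lt b hbn v hv).le
    · intro v hv j hj hj'
      exact hN.dist_step b hbn v hv j hj hj'
    · rintro t' s2 - - ⟨ht', hc2, hle, hge, hcl⟩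
      have hs := sum_scanCost_le (lim := n) hN.toCsr
      simp at ht
      refine ⟨by omega, hc2, ?_⟩
      -- along a shortest path no edge can be relaxed, so the labels do not exceed the distances
      have key : ∀ k, ∀ v < n, d b v = k → s2.arr a_val v ≤ k := by
        intro k
        induction k with
        | zero =>
          intro v hv h0
          obtain rfl := hN.eq_of_dist b hbn v hv h0
          have := hle b hv
          simpa using this
        | succ k ih =>
          intro v hv hk
          obtain ⟨y, hy, j, hj, hj', rfl, he⟩ := hN.dist_pred b hbn v hv (by omega)
          have := hcl y hy (hN.deg_lt y hy) j hj hj'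
          have := ih y hy (by omega)
          omega
      intro v hv
      exact le_antisymm (key _ v hv rfl) (hge v hv)

theorem wp_recordRow (hW : (n + 2) ^ 4 < size w) (hn : s.reg r_n = n)
    {b : ℕ} (hbn : b < n) (hb : s.reg r_best = b) {E D' : ℕ} (hE : s.reg r_E = E) (hED : E ≤ D')
    (hval : ∀ v < n, s.arr a_val v ≤ D') :
    wp w recordRow s (fun t s' => t ≤ 30 * n + 10 ∧ E ≤ s'.reg r_E ∧ s'.reg r_E ≤ D' ∧
      (∀ v < n, s.arr a_val v ≤ s'.reg r_E) ∧
      (∀ v < n, s'.arr a_T (b * n + v) = s.arr a_val v) ∧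
      ∀ x, ∀ v < n, x ≠ b → s'.arr a_T (x * n + v) = s.arr a_T (x * n + v)) := by
  unfold recordRow
  simp
  refine fun hb0 => ⟨lt_size_of_le hW (by omega), ?_⟩
  refine wp_conseq (wp_forTo (I := fun k s' => E ≤ s'.reg r_E ∧ s'.reg r_E ≤ D' ∧
      (∀ v < k, s.arr a_val v ≤ s'.reg r_E) ∧
      (∀ v < k, s'.arr a_T (b * n + v) = s.arr a_val v) ∧
      ∀ x, ∀ v < n, x ≠ b → s'.arr a_T (x * n + v) = s.arr a_T (x * n + v)) (T := fun _ => 20)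
    (a := 0) (b := n) rfl rfl (by decide) (by simp) (by simp [hn]) (Nat.zero_le n) ?_ ?_) ?_
  · simp [hE, hED]
  · rintro k s' _ hfr _ hk hik hn' ⟨h1, h2, h3, h4, h5⟩
    have eb : s'.reg r_best = b := by rw [hfr.reg _ rfl]; simp [hb]
    have ev : s'.arr a_val = s.arr a_val := by rw [hfr.arr _ rfl]; simp
    have hidx := index_lt hbn hk
    have hT : (∀ v ≤ k, Function.update (s'.arr a_T) (b * n + k) (s.arr a_val k) (b * n + v) =
        s.arr a_val v) ∧ ∀ x, ∀ v < n, ¬ x = b →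
        Function.update (s'.arr a_T) (b * n + k) (s.arr a_val k) (x * n + v) =
          s.arr a_T (x * n + v) := by
      constructor
      · intro v hv
        by_cases hvk : v = k
        · simp [hvk]
        · rw [Function.update_of_ne (by omega)]; exact h4 v (by omega)
      · intro x v hv hx
        rw [Function.update_of_ne (fun h => hx (index_inj hv hk h).1)]
        exact h5 x v hv hx
    simp [hik, hn', eb, ev]
    refine fun _ => ⟨⟨lt_size_of_le hW (by omega), lt_size_of_le hW (by omega)⟩,
      fun hlt _ => ⟨by omega, hval k hk, fun v hv => ?_, hT⟩,
      fun hle _ => ⟨h1, h2, fun v hv => ?_, hT⟩⟩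
    · by_cases hvk : v = k
      · simp [hvk]
      · have := h3 v (by omega); omega
    · by_cases hvk : v = k
      · simpa [hvk] using hle
      · exact h3 v (by omega)
  · rintro t s1 hfr _ ⟨ht, -, hI⟩
    simp at ht
    exact ⟨by omega, hI⟩

open Classical in
theorem wp_markRow (hN : Net n st fl d D) (hW : (n + 2) ^ 4 < size w) (hL : Loaded n st fl s)
    {b : ℕ} (hbn : b < n) (hb : s.reg r_best = b) :
    wp w markRow s (fun t s' => t ≤ 30 * (st (b + 1) - st b) + 20 ∧
      ∀ x, s'.arr a_dom x =
        if s.arr a_dom x = 0 ∧ ∃ j, st b ≤ j ∧ j < st (b + 1) ∧ fl j = x then b + 1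
        else s.arr a_dom x) := by
  unfold markRow
  simp [hL.st, hb]
  refine fun hb0 _ => ⟨⟨lt_size_of_le hW (by omega), lt_size_of_le hW (by omega)⟩, ?_⟩
  refine wp_conseq (wp_forTo (I := fun k s' => ∀ x, s'.arr a_dom x =
        if s.arr a_dom x = 0 ∧ ∃ j, st b ≤ j ∧ j < k ∧ fl j = x then b + 1
        else s.arr a_dom x) (T := fun _ => 20)
    (a := st b) (b := st (b + 1)) rfl rfl (by decide) (by simp) (by simp)
    (hN.mono b hbn) ?_ ?_) ?_
  · intro x
    rw [if_neg]
    · simp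
    · rintro ⟨-, j, h1, h2, -⟩; omega
  · intro k s' _ hfr hk1 hk2 hik _ hI
    have eb : s'.reg r_best = b := by rw [hfr.reg _ rfl]; simp [hb]
    have ef : s'.arr a_fl = fl := by rw [hfr.arr _ rfl]; simp [hL.fl]
    simp [hik, eb, ef]
    refine fun _ => ⟨fun _ => lt_size_of_le hW (by omega), fun h0 _ =>
      ⟨⟨lt_size_of_le hW (by omega), lt_size_of_le hW (by omega)⟩, fun x => ?_⟩, fun h0 _ x => ?_⟩
    · by_cases hx : x = fl k
      · subst hx
        rw [Function.update_self]
        have h1 : s.arr a_dom (fl k) = 0 := by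
          have := hI (fl k)
          rw [h0] at this
          split at this <;> omega
        rw [if_pos ⟨h1, k, hk1, by omega, rfl⟩]
      · rw [Function.update_of_ne hx, hI x]
        refine if_congr (and_congr Iff.rfl ⟨?_, ?_⟩) rfl rfl
        · rintro ⟨j, h1, h2, h3⟩; exact ⟨j, h1, by omega, h3⟩
        · rintro ⟨j, h1, h2, h3⟩
          have : j ≠ k := by rintro rfl; exact hx h3.symm
          exact ⟨j, h1, by omega, h3⟩
    · rw [hI x]
      by_cases hx : x = fl k
      · subst hx
        have hne := hI (fl k)
        by_cases hd : s.arr a_dom (fl k) = 0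
        · have hex : ∃ j, st b ≤ j ∧ j < k ∧ fl j = fl k := by
            by_contra hc
            rw [if_neg (fun h => hc h.2)] at hne
            exact h0 (hne.trans hd)
          obtain ⟨j, h1, h2, h3⟩ := hex
          rw [if_pos ⟨hd, j, h1, h2, h3⟩, if_pos ⟨hd, j, h1, by omega, h3⟩]
        · rw [if_neg (fun h => hd h.1), if_neg (fun h => hd h.1)]
      · refine if_congr (and_congr Iff.rfl ⟨?_, ?_⟩) rfl rfl
        · rintro ⟨j, h1, h2, h3⟩; exact ⟨j, h1, by omega, h3⟩
        · rintro ⟨j, h1, h2, h3⟩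
          have : j ≠ k := by rintro rfl; exact hx h3.symm
          exact ⟨j, h1, by omega, h3⟩
  · rintro t s1 hfr _ ⟨ht, -, hI⟩
    simp at ht
    exact ⟨by omega, hI⟩

theorem wp_countRow (hN : Net n st fl d D) (hW : (n + 2) ^ 4 < size w) (hL : Loaded n st fl s)
    {u : ℕ} (hun : u < n) (hu : s.reg r_u = u) {S : ℕ} (hS : s.reg r_s = S) :
    wp w countRow s (fun t s' => t ≤ 50 * (st (u + 1) - st u) + 20 ∧
      s'.reg r_c = hits st fl (needy n st S (s.arr a_dom)) u) := by
  unfold countRow degE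
  simp [hL.st, hu]
  refine fun hb0 => ⟨lt_size_of_le hW (by omega), fun _ _ => ⟨⟨lt_size_of_le hW (by omega),
    lt_size_of_le hW (by omega)⟩, ?_⟩⟩
  refine wp_conseq (wp_forTo (I := fun k s' => s'.reg r_c =
      {j ∈ Finset.Ico (st u) k | fl j ∈ needy n st S (s.arr a_dom)}.card) (T := fun _ => 40)
    (a := st u) (b := st (u + 1)) rfl rfl (by decide) (by simp) (by simp)
    (hN.mono u hun) ?_ ?_) ?_
  · simp
  · intro k s' _ hfr hk1 hk2 hik _ hI
    have hfl := hN.fl_lt u hun k hk1 hk2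
    have eS : s'.reg r_s = S := by rw [hfr.reg _ rfl]; simp [hS]
    have est : s'.arr a_st = st := by rw [hfr.arr _ rfl]; simp [hL.st]
    have efl : s'.arr a_fl = fl := by rw [hfr.arr _ rfl]; simp [hL.fl]
    have ed : s'.arr a_dom = s.arr a_dom := by rw [hfr.arr _ rfl]; simp
    have hcard : {j ∈ Finset.Ico (st u) k | fl j ∈ needy n st S (s.arr a_dom)}.card ≤ n * n := by
      refine (Finset.card_filter_le _ _).trans ?_
      have := hN.le (u + 1) hun
      simp; omega
    have hstep : {j ∈ Finset.Ico (st u) (k + 1) | fl j ∈ needy n st S (s.arr a_dom)}.card =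
        {j ∈ Finset.Ico (st u) k | fl j ∈ needy n st S (s.arr a_dom)}.card +
          if fl k ∈ needy n st S (s.arr a_dom) then 1 else 0 := by
      rw [← Finset.insert_Ico_right_eq_Ico_add_one hk1, Finset.filter_insert]
      split
      · rw [Finset.card_insert_of_notMem (by simp)]
      · rfl
    rw [hstep]
    simp [hik, eS, est, efl, ed, hI, needy, hfl]
    refine fun _ => ⟨fun _ => lt_size_of_le hW (by omega), fun h0 => ⟨fun _ =>
      ⟨lt_size_of_le hW (by omega), lt_size_of_le hW (by omega)⟩, fun hlt _ => ?_, fun hle _ =>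
      ⟨⟨lt_size_of_le hW (by omega), lt_size_of_le hW ?_⟩, ?_⟩⟩, fun h0 _ => ?_⟩
    · intro _; exact hlt
    · simp only [needy, Finset.mem_filter, Finset.mem_range] at hcard
      omega
    · simp [h0, hle]
    · intro h; exact absurd h h0
  · rintro t s1 hfr _ ⟨ht, -, hI⟩
    simp at ht
    exact ⟨by omega, hI⟩

theorem wp_findBest (hN : Net n st fl d D) (hW : (n + 2) ^ 4 < size w) (hL : Loaded n st fl s)
    {S : ℕ} (hS : s.reg r_s = S) :
    wp w findBest s (fun t s' => t ≤ 100 * (n + 1 + st n) ∧ s'.reg r_best < n ∧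
      s'.reg r_bc = hits st fl (needy n st S (s.arr a_dom)) (s'.reg r_best) ∧
      ∀ y < n, hits st fl (needy n st S (s.arr a_dom)) y ≤ s'.reg r_bc) := by
  set h := hits st fl (needy n st S (s.arr a_dom)) with hh
  have hpos := hN.pos
  unfold findBest
  simp
  refine fun hb0 => ⟨lt_size_of_le hW (by omega), fun _ => ⟨lt_size_of_le hW (by omega), fun _ =>
    ⟨lt_size_of_le hW (by omega), ?_⟩⟩⟩
  refine wp_conseq (wp_forTo (I := fun k s' => s'.reg r_best < n ∧
      s'.reg r_bc ≤ h (s'.reg r_best) ∧ ∀ y < k, h y ≤ s'.reg r_bc)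
    (T := fun u => 40 + 50 * (st (u + 1) - st u))
    (a := 0) (b := n) rfl rfl (by decide) (by simp) (by simp [hL.n]) (Nat.zero_le n) ?_ ?_) ?_
  · simp [hpos]
  · rintro k s' _ hfr _ hk hik _ ⟨h1, h2, h3⟩
    have eS : s'.reg r_s = S := by rw [hfr.reg _ rfl]; simp [hS]
    have ed : s'.arr a_dom = s.arr a_dom := by rw [hfr.arr _ rfl]; simp
    have hL' : Loaded n st fl s' := Loaded.of_frame
      ⟨by simp [hL.n], by simp [hL.st], by simp [hL.fl]⟩ hfr rfl rfl rfl
    rw [wp_seq]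
    refine wp_conseq (wp_countRow hN hW hL' hk hik eS) ?_
    rintro t s1 hfr1 _ ⟨ht, hc⟩
    rw [ed, ← hh] at hc
    have e1 : s1.reg r_bc = s'.reg r_bc := hfr1.reg _ rfl
    have e2 : s1.reg r_best = s'.reg r_best := hfr1.reg _ rfl
    have e3 : s1.reg r_u = k := (hfr1.reg _ rfl).trans hik
    simp [e1, e2, e3, hc]
    refine ⟨fun hlt _ _ => ⟨by omega, hk, fun y hy => ?_⟩, fun hle _ =>
      ⟨by omega, h1, h2, fun y hy => ?_⟩⟩
    · by_cases hyk : y = k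
      · rw [hyk]
      · have := h3 y (by omega); omega
    · by_cases hyk : y = k
      · rwa [hyk]
      · exact h3 y (by omega)
  · rintro t s1 hfr _ ⟨ht, -, h1, h2, h3⟩
    have := hN.toCsr.sum_time_le 40 50
    exact ⟨by omega, h1, le_antisymm h2 (h3 _ h1), h3⟩

end
end WordRAM

/-- The neighbours of `y`. -/
def nbrSet (st fl : ℕ → ℕ) (y : ℕ) : Finset ℕ := (Finset.Ico (st y) (st (y + 1))).image fl

theorem mem_nbrSet {st fl : ℕ → ℕ} {x y : ℕ} :
    x ∈ nbrSet st fl y ↔ ∃ j, st y ≤ j ∧ j < st (y + 1) ∧ fl j = x := by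
  simp [nbrSet, and_assoc]

/-- A bound for the number of rounds that the greedy algorithm needs to dominate `k` vertices, when
each round dominates at least a fraction `1 / q` of those that are left. -/
def roundBound (q k : ℕ) : ℕ := ⌊(q : ℚ) * harmonic k⌋₊

/-- The terms `1 / (k - b + 1), …, 1 / k` of the harmonic sum are all at least `1 / k`. -/
theorem div_le_harmonic_sub {k b : ℕ} (hbk : b ≤ k) :
    (b : ℚ) / k ≤ harmonic k - harmonic (k - b) := by
  unfold harmonic
  rw [← Finset.sum_range_add_sum_Ico _ (Nat.sub_le k b), add_sub_cancel_left]
  have h1 : ∀ i ∈ Finset.Ico (k - b) k, (k : ℚ)⁻¹ ≤ ((i + 1 : ℕ) : ℚ)⁻¹ := by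
    intro i hi
    have := (Finset.mem_Ico.1 hi).2
    have h2 : (((i + 1 : ℕ)) : ℚ) ≤ k := by exact_mod_cast this
    have h3 : (0 : ℚ) < ((i + 1 : ℕ) : ℚ) := by positivity
    exact inv_anti₀ h3 h2
  have h4 := Finset.card_nsmul_le_sum _ _ _ h1
  rw [Nat.card_Ico, Nat.sub_sub_self hbk, nsmul_eq_mul] at h4
  rwa [div_eq_mul_inv]

/-- A round that dominates `b ≥ k / q` of the `k` remaining vertices uses up one unit of the
bound. -/
theorem roundBound_lt {q k b k' : ℕ} (hb : 0 < b) (hk : k' + b ≤ k) (hq : k ≤ q * b) :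
    roundBound q k' + 1 ≤ roundBound q k := by
  have h0 : (0 : ℚ) < k := by exact_mod_cast (by omega : 0 < k)
  have h1 := div_le_harmonic_sub (show b ≤ k by omega)
  have h2 : harmonic k' ≤ harmonic (k - b) := by
    unfold harmonic
    exact Finset.sum_le_sum_of_subset_of_nonneg
      (Finset.range_mono (by omega)) fun _ _ _ => by positivity
  have h3 : (1 : ℚ) ≤ q * ((b : ℚ) / k) := by
    rw [← mul_div_assoc, one_le_div h0]
    exact_mod_cast hq
  have hq0 : (0 : ℚ) ≤ q := by positivity
  have h4 : (q : ℚ) * harmonic k' + 1 ≤ q * harmonic k := by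
    have := mul_le_mul_of_nonneg_left h1 hq0
    have := mul_le_mul_of_nonneg_left h2 hq0
    linarith
  have h5 : (0 : ℚ) ≤ q * harmonic k' := by
    unfold harmonic
    exact mul_nonneg hq0 (Finset.sum_nonneg fun _ _ => by positivity)
  unfold roundBound
  rw [← Nat.floor_add_one h5]
  exact Nat.floor_le_floor h4

section

variable {n : ℕ} {st fl : ℕ → ℕ} {d : ℕ → ℕ → ℕ} {D : ℕ}

theorem Net.card_nbrSet (hN : Net n st fl d D) {y : ℕ} (hy : y < n) :
    (nbrSet st fl y).card = st (y + 1) - st y := by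
  rw [nbrSet, Finset.card_image_of_injOn, Nat.card_Ico]
  intro j hj j' hj' h
  simp only [Finset.coe_Ico, Set.mem_Ico] at hj hj'
  exact hN.nodup y hy j hj.1 hj.2 j' hj'.1 hj'.2 h

theorem Net.nbrSet_comm (hN : Net n st fl d D) {x y : ℕ} (hy : y < n)
    (h : x ∈ nbrSet st fl y) : x < n ∧ y ∈ nbrSet st fl x := by
  obtain ⟨j, h1, h2, rfl⟩ := mem_nbrSet.1 h
  exact ⟨hN.fl_lt y hy j h1 h2, mem_nbrSet.2 (hN.symm y hy j h1 h2)⟩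

theorem Net.hits_eq (hN : Net n st fl d D) {y : ℕ} (hy : y < n) (U : Finset ℕ) :
    hits st fl U y = {x ∈ U | x ∈ nbrSet st fl y}.card := by
  have h1 : {x ∈ U | x ∈ nbrSet st fl y} =
      {j ∈ Finset.Ico (st y) (st (y + 1)) | fl j ∈ U}.image fl := by
    ext x
    simp only [Finset.mem_filter, Finset.mem_image, mem_nbrSet, Finset.mem_Ico]
    constructor
    · rintro ⟨hU, j, h1, h2, rfl⟩; exact ⟨j, ⟨⟨h1, h2⟩, hU⟩, rfl⟩
    · rintro ⟨j, ⟨⟨h1, h2⟩, hU⟩, rfl⟩; exact ⟨hU, j, h1, h2, rfl⟩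
  rw [h1, Finset.card_image_of_injOn, hits]
  intro j hj j' hj' h
  simp only [Finset.coe_filter, Finset.mem_Ico, Set.mem_ofPred_eq] at hj hj'
  exact hN.nodup y hy j hj.1.1 hj.1.2 j' hj'.1.1 hj'.1.2 h

/-- Double counting: some vertex has many neighbours in a set of vertices of high degree. -/
theorem Net.mul_card_le (hN : Net n st fl d D) {S c : ℕ} {dom : ℕ → ℕ}
    (hc : ∀ y < n, hits st fl (needy n st S dom) y ≤ c) :
    S * (needy n st S dom).card ≤ n * c := by
  set U := needy n st S dom with hU
  have hUn : ∀ x ∈ U, x < n ∧ S ≤ st (x + 1) - st x := fun x hx => by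
    simp only [hU, needy, Finset.mem_filter, Finset.mem_range] at hx
    exact ⟨hx.1, hx.2.2⟩
  have h1 : ∑ y ∈ Finset.range n, hits st fl U y = ∑ x ∈ U, (st (x + 1) - st x) := by
    have h2 := Finset.sum_card_bipartiteAbove_eq_sum_card_bipartiteBelow
      (s := Finset.range n) (t := U) (fun y x => x ∈ nbrSet st fl y)
    rw [Finset.sum_congr rfl fun y hy => hN.hits_eq (Finset.mem_range.1 hy) U]
    refine h2.trans (Finset.sum_congr rfl fun x hx => ?_)
    rw [← hN.card_nbrSet (hUn x hx).1]
    congr 1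
    ext y
    simp only [Finset.bipartiteBelow, Finset.mem_filter, Finset.mem_range]
    exact ⟨fun h => (hN.nbrSet_comm h.1 h.2).2, fun h => hN.nbrSet_comm (hUn x hx).1 h⟩
  calc S * U.card = ∑ x ∈ U, S := by rw [Finset.sum_const, smul_eq_mul, mul_comm]
    _ ≤ ∑ x ∈ U, (st (x + 1) - st x) := Finset.sum_le_sum fun x hx => (hUn x hx).2
    _ = ∑ y ∈ Finset.range n, hits st fl U y := h1.symm
    _ ≤ ∑ y ∈ Finset.range n, c := Finset.sum_le_sum fun y hy => hc y (Finset.mem_range.1 hy)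
    _ = n * c := by rw [Finset.sum_const, smul_eq_mul, Finset.card_range]

open Classical in
theorem Net.card_needy_mark (hN : Net n st fl d D) {S b : ℕ} (hb : b < n) {dom dom' : ℕ → ℕ}
    (h : ∀ x, dom' x = if dom x = 0 ∧ ∃ j, st b ≤ j ∧ j < st (b + 1) ∧ fl j = x then b + 1
      else dom x) :
    (needy n st S dom').card + hits st fl (needy n st S dom) b ≤ (needy n st S dom).card := by
  rw [hN.hits_eq hb, add_comm]
  have h1 : needy n st S dom' ⊆ {x ∈ needy n st S dom | ¬ x ∈ nbrSet st fl b} := by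
    intro x hx
    simp only [needy, Finset.mem_filter, h x, mem_nbrSet] at hx ⊢
    obtain ⟨h1, h2, h3⟩ := hx
    split at h2
    · omega
    · rename_i hne
      exact ⟨⟨h1, h2, h3⟩, fun h4 => hne ⟨h2, h4⟩⟩
  calc _ ≤ _ := Nat.add_le_add_left (Finset.card_le_card h1) _
    _ = _ := Finset.card_filter_add_card_filter_not _

end

namespace WordRAM

open WordRAM.Expr WordRAM.Program

/-- One round of the greedy algorithm, with a breadth-first search from the new dominator. -/
def greedyRound : Program := findBest ;; markRow ;; bfs ;; recordRow

/-- Dominate all vertices of degree at least `r_s`.  There is at least one round. -/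
def greedy : Program := r_bc ≔ lit 1 ;; loop (reg r_bc) greedyRound

/-- The invariant of the greedy algorithm.  A dominator has had its distances recorded in `a_T`, and
`r_E` is at least every recorded distance.  The loop ends when a round finds nothing to dominate;
by `Net.mul_card_le`, all vertices of high degree have a dominator then. -/
structure GreedyInv (n : ℕ) (st fl : ℕ → ℕ) (d : ℕ → ℕ → ℕ) (D S : ℕ) (s : State) : Prop where
  cnt : ∀ k, s.arr a_cnt k = 0
  dom : ∀ x < n, ∀ b, s.arr a_dom x = b + 1 → b < n ∧ x ∈ nbrSet st fl b ∧
    ∀ v < n, s.arr a_T (b * n + v) = d b v ∧ d b v ≤ s.reg r_E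
  le_diam : s.reg r_E ≤ D
  final : s.reg r_bc = 0 → needy n st S (s.arr a_dom) = ∅ ∧ ∃ b < n, ∀ v < n, d b v ≤ s.reg r_E

section

variable {w n : ℕ} {st fl : ℕ → ℕ} {d : ℕ → ℕ → ℕ} {D : ℕ} {s : State}

theorem wp_greedyRound (hN : Net n st fl d D) (hW : (n + 2) ^ 4 < size w) (hL : Loaded n st fl s)
    {S : ℕ} (hS : s.reg r_s = S) (hS0 : 0 < S) (h : GreedyInv n st fl d D S s) :
    wp w greedyRound s (fun t s' => t ≤ 600 * (n + 1 + st n) ∧ GreedyInv n st fl d D S s' ∧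
      S * (needy n st S (s.arr a_dom)).card ≤ n * s'.reg r_bc ∧
      (needy n st S (s'.arr a_dom)).card + s'.reg r_bc ≤ (needy n st S (s.arr a_dom)).card) := by
  unfold greedyRound
  rw [wp_seq]
  refine wp_conseq (wp_findBest hN hW hL hS) ?_
  rintro t1 s1 hf1 - ⟨ht1, hbn, hbc, hmax⟩
  obtain ⟨b, hb⟩ : ∃ b, s1.reg r_best = b := ⟨_, rfl⟩
  rw [hb] at hbn hbc
  have hL1 := hL.of_frame hf1 rfl rfl rfl
  rw [wp_seq]
  refine wp_conseq (wp_markRow hN hW hL1 hbn hb) ?_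
  rintro t2 s2 hf2 - ⟨ht2, hdom⟩
  have hL2 := hL1.of_frame hf2 rfl rfl rfl
  have hb2 : s2.reg r_best = b := (hf2.reg _ rfl).trans hb
  have hcnt2 : ∀ k, s2.arr a_cnt k = 0 := by
    rw [hf2.arr _ rfl, hf1.arr _ rfl]; exact h.cnt
  rw [wp_seq]
  refine wp_conseq (wp_bfs hN hW hL2 hbn hb2 hcnt2) ?_
  rintro t3 s3 hf3 - ⟨ht3, hcnt3, hval⟩
  have hL3 := hL2.of_frame hf3 rfl rfl rfl
  have hb3 : s3.reg r_best = b := (hf3.reg _ rfl).trans hb2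
  have hE3 : s3.reg r_E = s.reg r_E := by
    rw [hf3.reg _ rfl, hf2.reg _ rfl, hf1.reg _ rfl]
  refine wp_conseq (wp_recordRow hW hL3.n hbn hb3 hE3 h.le_diam
    (fun v hv => by rw [hval v hv]; exact hN.le_diam b hbn v hv)) ?_
  rintro t4 s4 hf4 - ⟨ht4, hE4, hD4, hmax4, hT4, hT4'⟩
  have ed1 : s1.arr a_dom = s.arr a_dom := hf1.arr _ rfl
  have ed4 : s4.arr a_dom = s2.arr a_dom := by rw [hf4.arr _ rfl, hf3.arr _ rfl]
  have eT : s3.arr a_T = s.arr a_T := by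
    rw [hf3.arr _ rfl, hf2.arr _ rfl, hf1.arr _ rfl]
  have ebc : s4.reg r_bc = s1.reg r_bc := by
    rw [hf4.reg _ rfl, hf3.reg _ rfl, hf2.reg _ rfl]
  rw [ed1] at hdom
  have hcount := hN.mul_card_le hmax
  have hcard := hN.card_needy_mark (S := S) hbn hdom
  rw [ebc, ed4]
  refine ⟨?_, ⟨?_, ?_, hD4, ?_⟩, hcount, ?_⟩
  · have h1 : st (b + 1) ≤ st n := hN.toCsr.start_le (by omega)
    omega
  · rw [hf4.arr _ rfl]; exact hcnt3
  · intro x hx b' hdx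
    have hrow : ∀ v < n, s4.arr a_T (b * n + v) = d b v ∧ d b v ≤ s4.reg r_E := fun v hv =>
      ⟨(hT4 v hv).trans (hval v hv), (hval v hv) ▸ hmax4 v hv⟩
    rw [ed4, hdom x] at hdx
    split at hdx
    · rename_i hc
      obtain rfl : b = b' := by omega
      exact ⟨hbn, mem_nbrSet.2 hc.2, hrow⟩
    · obtain ⟨h1, h2, h3⟩ := h.dom x hx b' hdx
      refine ⟨h1, h2, ?_⟩
      by_cases hbb : b' = b
      · subst hbb; exact hrow
      · intro v hv
        rw [hT4' b' v hv hbb, eT]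
        exact ⟨(h3 v hv).1, (h3 v hv).2.trans hE4⟩
  · intro h0
    rw [ebc] at h0
    rw [h0, Nat.mul_zero, Nat.le_zero, Nat.mul_eq_zero] at hcount
    have hc0 : (needy n st S (s.arr a_dom)).card = 0 := by omega
    refine ⟨?_, b, hbn, fun v hv => (hval v hv) ▸ hmax4 v hv⟩
    rw [ed4, ← Finset.card_eq_zero]
    omega
  · rw [hbc]; exact hcard

/-- Each round dominates at least a fraction `S / n ≥ 1 / q` of the vertices of high degree that are
left, so there are at most `roundBound q n` rounds before the last. -/
theorem wp_greedy (hN : Net n st fl d D) (hW : (n + 2) ^ 4 < size w) (hL : Loaded n st fl s)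
    {S q : ℕ} (hS : s.reg r_s = S) (hS0 : 0 < S) (hq : n ≤ q * S)
    (hcnt : ∀ k, s.arr a_cnt k = 0) (hdom : ∀ x, s.arr a_dom x = 0) (hE : s.reg r_E = 0) :
    wp w greedy s (fun t s' => t ≤ 700 * (n + 1 + st n) * (roundBound q n + 2) ∧
      GreedyInv n st fl d D S s' ∧ s'.reg r_bc = 0) := by
  unfold greedy
  simp only [wp_seq, wp_assign]
  refine fun hb0 => ⟨by simp; exact hb0.one_lt, ?_⟩
  refine wp_conseq (wp_loop (I := GreedyInv n st fl d D S)
    (Φ := fun s' => if s'.reg r_bc = 0 then 0 else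
      700 * (n + 1 + st n) * (roundBound q (needy n st S (s'.arr a_dom)).card + 1))
    ?_ ?_ ?_) ?_
  · intros; simp
  · intro s' _ hf hI hg
    have hg' : s'.reg r_bc ≠ 0 := hg
    have hL' : Loaded n st fl s' := Loaded.of_frame
      ⟨by simp [hL.n], by simp [hL.st], by simp [hL.fl]⟩ hf rfl rfl rfl
    have hS' : s'.reg r_s = S := by rw [hf.reg _ rfl]; simp [hS]
    refine wp_conseq (wp_greedyRound hN hW hL' hS' hS0 hI) ?_
    rintro t s2 - - ⟨ht, hI2, h1, h2⟩
    refine ⟨hI2, ?_⟩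
    rw [if_neg hg']
    simp only [Expr.cost]
    -- the last round dominates nothing, and is paid for by the summand `1` in the potential
    by_cases h0 : s2.reg r_bc = 0
    · rw [if_pos h0]
      nlinarith [Nat.zero_le (700 * (n + 1 + st n) *
        roundBound q (needy n st S (s'.arr a_dom)).card)]
    · rw [if_neg h0]
      have h3 : (needy n st S (s'.arr a_dom)).card ≤ q * s2.reg r_bc := by
        refine Nat.le_of_mul_le_mul_left (h1.trans ?_) hS0
        calc n * s2.reg r_bc ≤ (q * S) * s2.reg r_bc := Nat.mul_le_mul_right _ hq
          _ = S * (q * s2.reg r_bc) := by ring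
      have h4 := roundBound_lt (by omega) h2 h3
      have h5 := Nat.mul_le_mul_left (700 * (n + 1 + st n)) h4
      generalize hK : 700 * (n + 1 + st n) = K at h5 ⊢
      simp only [Nat.mul_add, Nat.mul_one] at h5 ⊢
      omega
  · exact ⟨by simpa using hcnt, by simp [hdom], by simp [hE], by simp⟩
  · rintro t s' - - ⟨hI, h0, ht⟩
    refine ⟨?_, hI, h0⟩
    have h1 : roundBound q (needy n st S (s.arr a_dom)).card ≤ roundBound q n := by
      have h2 : (needy n st S (s.arr a_dom)).card ≤ n := by
        refine (Finset.card_filter_le _ _).trans ?_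
        simp
      refine Nat.floor_le_floor (mul_le_mul_of_nonneg_left ?_ (by positivity))
      unfold harmonic
      exact Finset.sum_le_sum_of_subset_of_nonneg
        (Finset.range_mono h2) fun _ _ _ => by positivity
    have h5 := Nat.mul_le_mul_left (700 * (n + 1 + st n)) h1
    simp at ht
    simp only [Expr.cost]
    generalize hK : 700 * (n + 1 + st n) = K at h5 ht ⊢
    simp only [Nat.mul_add, Nat.mul_one] at ht h5 ⊢
    omega

end
end WordRAM

/-! ### Pairs of vertices of low degree -/

section

variable {n : ℕ} {st fl : ℕ → ℕ} {d : ℕ → ℕ → ℕ} {D : ℕ}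

theorem Net.mem_nbrSet_of_dist_eq_one (hN : Net n st fl d D) {u v : ℕ} (hu : u < n) (hv : v < n)
    (h : d u v = 1) : v ∈ nbrSet st fl u := by
  obtain ⟨y, hy, j, h1, h2, h3, h4⟩ := hN.dist_pred u hu v hv (by omega)
  obtain rfl := hN.eq_of_dist u hu y hy (by omega)
  exact mem_nbrSet.2 ⟨j, h1, h2, h3⟩

theorem Net.exists_nbrSet_pred (hN : Net n st fl d D) {u v : ℕ} (hu : u < n) (hv : v < n)
    (h : d u v ≠ 0) : ∃ y < n, y ∈ nbrSet st fl v ∧ v ∈ nbrSet st fl y ∧ d u v = d u y + 1 := by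
  obtain ⟨y, hy, j, h1, h2, h3, h4⟩ := hN.dist_pred u hu v hv h
  have hm : v ∈ nbrSet st fl y := mem_nbrSet.2 ⟨j, h1, h2, h3⟩
  exact ⟨y, hy, (hN.nbrSet_comm hy hm).2, hm, h4⟩

theorem Net.dist_nbr_le (hN : Net n st fl d D) {u y x : ℕ} (hu : u < n) (hy : y < n)
    (h : x ∈ nbrSet st fl y) : d u x ≤ d u y + 1 := by
  obtain ⟨j, h1, h2, rfl⟩ := mem_nbrSet.1 h
  exact hN.dist_step u hu y hy j h1 h2

/-- Two different vertices are at distance at most three if and only if some neighbours of theirs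
are equal or adjacent. -/
theorem Net.dist_le_three_iff (hN : Net n st fl d D) {u v : ℕ} (hu : u < n) (hv : v < n)
    (hne : u ≠ v) : d u v ≤ 3 ↔
      ∃ x ∈ nbrSet st fl u, ∃ y ∈ nbrSet st fl v, x = y ∨ y ∈ nbrSet st fl x := by
  constructor
  · intro h
    have h0 : d u v ≠ 0 := fun h0 => hne (hN.eq_of_dist u hu v hv h0)
    obtain ⟨y, hy, hyv, hvy, hd⟩ := hN.exists_nbrSet_pred hu hv h0
    rcases Nat.eq_zero_or_pos (d u y) with h1 | h1
    · -- at distance one, the edge joins the neighbour `v` of `u` and the neighbour `u` of `v`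
      have hvu := hN.mem_nbrSet_of_dist_eq_one hu hv (by omega)
      have huv := (hN.nbrSet_comm hu hvu).2
      exact ⟨v, hvu, u, huv, Or.inr huv⟩
    · obtain ⟨x, hx, hxy, hyx, hd'⟩ := hN.exists_nbrSet_pred hu hy (by omega)
      rcases Nat.eq_zero_or_pos (d u x) with h2 | h2
      · exact ⟨y, hN.mem_nbrSet_of_dist_eq_one hu hy (by omega), y, hyv, Or.inl rfl⟩
      · exact ⟨x, hN.mem_nbrSet_of_dist_eq_one hu hx (by omega), y, hyv, Or.inr hyx⟩
  · rintro ⟨x, hx, y, hy, hxy⟩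
    obtain ⟨hxn, -⟩ := hN.nbrSet_comm hu hx
    obtain ⟨hyn, hvy⟩ := hN.nbrSet_comm hv hy
    have h1 := hN.dist_nbr_le hu hu hx
    have h2 := hN.dist_nbr_le hu hyn hvy
    rw [hN.dist_self u hu] at h1
    rcases hxy with rfl | h
    · omega
    · have := hN.dist_nbr_le hu hxn h
      omega

end

namespace WordRAM

open WordRAM.Expr WordRAM.Program

/-- Fill row `r_u` of the adjacency matrix `a_M`, in which every vertex counts as adjacent to
itself. -/
def adjRow : Program :=
  .store a_M (reg r_u *ₑ reg r_n +ₑ reg r_u) (lit 1) ;;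
  r_j ≔ cell a_st (reg r_u) ;;
  r_h ≔ cell a_st (reg r_u +ₑ lit 1) ;;
  forTo r_j r_h (.store a_M (reg r_u *ₑ reg r_n +ₑ cell a_fl (reg r_j)) (lit 1))

/-- Fill the adjacency matrix. -/
def buildMatrix : Program := r_u ≔ lit 0 ;; forTo r_u r_n adjRow

/-- Set `r_c` if a neighbour of `r_v` is equal or adjacent to `r_x`. -/
def scanRow : Program :=
  r_j ≔ cell a_st (reg r_v) ;;
  r_h ≔ cell a_st (reg r_v +ₑ lit 1) ;;
  forTo r_j r_h (cond (cell a_M (reg r_x *ₑ reg r_n +ₑ cell a_fl (reg r_j))) (r_c ≔ lit 1) skip)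

/-- Set `r_c` if the distance of the different vertices `r_u` and `r_v` is at most three. -/
def scanPair : Program :=
  r_c ≔ lit 0 ;;
  r_i ≔ cell a_st (reg r_u) ;;
  r_k ≔ cell a_st (reg r_u +ₑ lit 1) ;;
  forTo r_i r_k (r_x ≔ cell a_fl (reg r_i) ;; scanRow)

/-- Raise `r_E` to four if the distance of `r_u` and `r_v` is at least four. -/
def checkPair : Program :=
  scanPair ;;
  cond (reg r_c) skip (cond (lt (reg r_E) (lit 4)) (r_E ≔ lit 4) skip)

/-- Check all pairs of vertices of degree less than `r_s`. -/
def checkPairs : Program :=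
  r_u ≔ lit 0 ;;
  forTo r_u r_n
    (cond (lt (degE (reg r_u)) (reg r_s))
      (r_v ≔ lit 0 ;;
       forTo r_v r_u (cond (lt (degE (reg r_v)) (reg r_s)) checkPair skip))
      skip)

/-- `a_M` is the adjacency matrix, with ones on the diagonal. -/
def IsMatrix (n : ℕ) (st fl : ℕ → ℕ) (s : State) : Prop :=
  ∀ y < n, ∀ x < n, s.arr a_M (y * n + x) ≠ 0 ↔ y = x ∨ x ∈ nbrSet st fl y

section

variable {w n : ℕ} {st fl : ℕ → ℕ} {d : ℕ → ℕ → ℕ} {D : ℕ} {s : State}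

theorem wp_adjRow (hN : Net n st fl d D) (hW : (n + 2) ^ 4 < size w) (hL : Loaded n st fl s)
    {u : ℕ} (hun : u < n) (hu : s.reg r_u = u) :
    wp w adjRow s (fun t s' => t ≤ 30 * (st (u + 1) - st u) + 30 ∧
      ∀ y < n, ∀ x < n, s'.arr a_M (y * n + x) ≠ 0 ↔
        s.arr a_M (y * n + x) ≠ 0 ∨ y = u ∧ (u = x ∨ x ∈ nbrSet st fl u)) := by
  have hidx := index_lt hun hun
  unfold adjRow
  simp [hL.n, hL.st, hu]
  refine fun hb0 => ⟨⟨lt_size_of_le hW (by omega), lt_size_of_le hW (by omega)⟩,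
    lt_size_of_le hW (by omega), fun _ _ => ⟨⟨lt_size_of_le hW (by omega),
      lt_size_of_le hW (by omega)⟩, ?_⟩⟩
  refine wp_conseq (wp_forTo (I := fun k s' => ∀ y < n, ∀ x < n, s'.arr a_M (y * n + x) ≠ 0 ↔
        s.arr a_M (y * n + x) ≠ 0 ∨ y = u ∧ (u = x ∨ ∃ j, st u ≤ j ∧ j < k ∧ fl j = x))
    (T := fun _ => 10)
    (a := st u) (b := st (u + 1)) rfl rfl (by decide) (by simp) (by simp)
    (hN.mono u hun) ?_ ?_) ?_
  · intro y hy x hx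
    have hno : ¬ ∃ j, st u ≤ j ∧ j < st u ∧ fl j = x := by rintro ⟨j, h1, h2, -⟩; omega
    simp [hno]
    by_cases hyx : y = u ∧ u = x
    · obtain ⟨rfl, rfl⟩ := hyx; simp
    · rw [Function.update_of_ne (fun h => hyx ?_)]
      · simp [hyx]
      · obtain ⟨h1, h2⟩ := index_inj hx hun h
        exact ⟨h1, h2.symm⟩
  · intro k s' _ hfr hk1 hk2 hik _ hI
    have hfl := hN.fl_lt u hun k hk1 hk2
    have hL' : Loaded n st fl s' := Loaded.of_frame
      ⟨by simp [hL.n], by simp [hL.st], by simp [hL.fl]⟩ hfr rfl rfl rfl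
    have eu : s'.reg r_u = u := by rw [hfr.reg _ rfl]; simp [hu]
    have hidx' := index_lt hun hfl
    simp [hL'.n, hL'.fl, eu, hik]
    refine fun _ => ⟨⟨lt_size_of_le hW (by omega), lt_size_of_le hW (by omega)⟩,
      lt_size_of_le hW (by omega), fun y hy x hx => ?_⟩
    by_cases hyx : y = u ∧ x = fl k
    · obtain ⟨rfl, rfl⟩ := hyx
      simp
      exact Or.inr (Or.inr ⟨k, hk1, by omega, rfl⟩)
    · rw [Function.update_of_ne (fun h => hyx (index_inj hx hfl h))]
      have := hI y hy x hx
      simp only [ne_eq] at this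
      rw [this]
      refine or_congr Iff.rfl (and_congr_right fun hyu => or_congr Iff.rfl ⟨?_, ?_⟩)
      · rintro ⟨j, h1, h2, h3⟩; exact ⟨j, h1, by omega, h3⟩
      · rintro ⟨j, h1, h2, h3⟩
        have : j ≠ k := by rintro rfl; exact hyx ⟨hyu, h3.symm⟩
        exact ⟨j, h1, by omega, h3⟩
  · rintro t s1 hfr _ ⟨ht, -, hI⟩
    simp at ht
    refine ⟨by omega, fun y hy x hx => ?_⟩
    rw [mem_nbrSet]
    exact hI y hy x hx

theorem wp_buildMatrix (hN : Net n st fl d D) (hW : (n + 2) ^ 4 < size w) (hL : Loaded n st fl s)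
    (hM : ∀ i, s.arr a_M i = 0) :
    wp w buildMatrix s (fun t s' => t ≤ 50 * (n + 1 + st n) ∧ IsMatrix n st fl s') := by
  unfold buildMatrix
  simp
  refine fun hb0 => ⟨lt_size_of_le hW (by omega), ?_⟩
  refine wp_conseq (wp_forTo (I := fun k s' => ∀ y < n, ∀ x < n, s'.arr a_M (y * n + x) ≠ 0 ↔
        y < k ∧ (y = x ∨ x ∈ nbrSet st fl y))
    (T := fun u => 30 + 30 * (st (u + 1) - st u))
    (a := 0) (b := n) rfl rfl (by decide) (by simp) (by simp [hL.n]) (Nat.zero_le n) ?_ ?_) ?_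
  · simp [hM]
  · rintro k s' _ hfr _ hk hik _ hI
    have hL' : Loaded n st fl s' := Loaded.of_frame
      ⟨by simp [hL.n], by simp [hL.st], by simp [hL.fl]⟩ hfr rfl rfl rfl
    refine wp_conseq (wp_adjRow hN hW hL' hk hik) ?_
    rintro t s1 - _ ⟨ht, h1⟩
    refine ⟨by omega, fun y hy x hx => ?_⟩
    rw [setReg_arr, h1 y hy x hx, hI y hy x hx]
    constructor
    · rintro (⟨h2, h3⟩ | ⟨rfl, h3⟩)
      · exact ⟨by omega, h3⟩
      · exact ⟨by omega, h3⟩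
    · rintro ⟨h2, h3⟩
      by_cases hyk : y = k
      · subst hyk; exact Or.inr ⟨rfl, h3⟩
      · exact Or.inl ⟨by omega, h3⟩
  · rintro t s1 hfr _ ⟨ht, -, h1⟩
    have := hN.toCsr.sum_time_le 30 30
    refine ⟨by omega, fun y hy x hx => ?_⟩
    rw [h1 y hy x hx]
    exact and_iff_right hy

theorem wp_scanRow (hN : Net n st fl d D) (hW : (n + 2) ^ 4 < size w) (hL : Loaded n st fl s)
    (hM : IsMatrix n st fl s) {x v : ℕ} (hxn : x < n) (hx : s.reg r_x = x) (hvn : v < n)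
    (hv : s.reg r_v = v) :
    wp w scanRow s (fun t s' => t ≤ 30 * (st (v + 1) - st v) + 20 ∧
      (s'.reg r_c ≠ 0 ↔ s.reg r_c ≠ 0 ∨ ∃ y ∈ nbrSet st fl v, x = y ∨ y ∈ nbrSet st fl x)) := by
  unfold scanRow
  simp [hL.st, hv]
  refine fun hb0 _ => ⟨⟨lt_size_of_le hW (by omega), lt_size_of_le hW (by omega)⟩, ?_⟩
  refine wp_conseq (wp_forTo (I := fun k s' => s'.reg r_c ≠ 0 ↔ s.reg r_c ≠ 0 ∨
      ∃ j, st v ≤ j ∧ j < k ∧ (x = fl j ∨ fl j ∈ nbrSet st fl x))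
    (T := fun _ => 20)
    (a := st v) (b := st (v + 1)) rfl rfl (by decide) (by simp) (by simp)
    (hN.mono v hvn) ?_ ?_) ?_
  · have hno : ¬ ∃ j, st v ≤ j ∧ j < st v ∧ (x = fl j ∨ fl j ∈ nbrSet st fl x) := by
      rintro ⟨j, h1, h2, -⟩; omega
    simp [hno]
  · intro k s' _ hfr hk1 hk2 hik _ hI
    have hfl := hN.fl_lt v hvn k hk1 hk2
    have hL' : Loaded n st fl s' := Loaded.of_frame
      ⟨by simp [hL.n], by simp [hL.st], by simp [hL.fl]⟩ hfr rfl rfl rfl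
    have ex : s'.reg r_x = x := by rw [hfr.reg _ rfl]; simp [hx]
    have eM : s'.arr a_M = s.arr a_M := by rw [hfr.arr _ rfl]; simp
    have hidx' := index_lt hxn hfl
    have hMk := hM x hxn (fl k) hfl
    simp [hL'.n, hL'.fl, ex, hik, eM]
    refine ⟨fun _ => ⟨lt_size_of_le hW (by omega), lt_size_of_le hW (by omega)⟩,
      fun h0 _ => ⟨lt_size_of_le hW (by omega), ?_⟩, fun h0 _ => ?_⟩
    · exact Or.inr ⟨k, hk1, by omega, hMk.1 h0⟩
    · simp only [ne_eq] at hI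
      rw [hI]
      refine or_congr Iff.rfl ⟨?_, ?_⟩
      · rintro ⟨j, h1, h2, h3⟩; exact ⟨j, h1, by omega, h3⟩
      · rintro ⟨j, h1, h2, h3⟩
        have : j ≠ k := by rintro rfl; exact hMk.2 h3 h0
        exact ⟨j, h1, by omega, h3⟩
  · rintro t s1 hfr _ ⟨ht, -, hI⟩
    simp at ht
    refine ⟨by omega, hI.trans (or_congr Iff.rfl ⟨?_, ?_⟩)⟩
    · rintro ⟨j, h1, h2, h3⟩; exact ⟨fl j, mem_nbrSet.2 ⟨j, h1, h2, rfl⟩, h3⟩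
    · rintro ⟨y, hy, h3⟩
      obtain ⟨j, h1, h2, rfl⟩ := mem_nbrSet.1 hy
      exact ⟨j, h1, h2, h3⟩

theorem wp_scanPair (hN : Net n st fl d D) (hW : (n + 2) ^ 4 < size w) (hL : Loaded n st fl s)
    (hM : IsMatrix n st fl s) {u v : ℕ} (hun : u < n) (hu : s.reg r_u = u) (hvn : v < n)
    (hv : s.reg r_v = v) :
    wp w scanPair s (fun t s' =>
      t ≤ (st (u + 1) - st u) * (30 * (st (v + 1) - st v) + 40) + 20 ∧
      (s'.reg r_c ≠ 0 ↔
        ∃ x ∈ nbrSet st fl u, ∃ y ∈ nbrSet st fl v, x = y ∨ y ∈ nbrSet st fl x)) := by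
  unfold scanPair
  simp [hL.st, hu]
  refine fun hb0 => ⟨lt_size_of_le hW (by omega), fun _ _ => ⟨⟨lt_size_of_le hW (by omega),
    lt_size_of_le hW (by omega)⟩, ?_⟩⟩
  refine wp_conseq (wp_forTo (I := fun k s' => s'.reg r_c ≠ 0 ↔
      ∃ i, st u ≤ i ∧ i < k ∧ ∃ y ∈ nbrSet st fl v, fl i = y ∨ y ∈ nbrSet st fl (fl i))
    (T := fun _ => 30 * (st (v + 1) - st v) + 30)
    (a := st u) (b := st (u + 1)) rfl rfl (by decide) (by simp) (by simp)
    (hN.mono u hun) ?_ ?_) ?_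
  · have hno : ¬ ∃ i, st u ≤ i ∧ i < st u ∧
        ∃ y ∈ nbrSet st fl v, fl i = y ∨ y ∈ nbrSet st fl (fl i) := by
      rintro ⟨j, h1, h2, -⟩; omega
    simp [hno]
  · intro k s' _ hfr hk1 hk2 hik _ hI
    have hfl := hN.fl_lt u hun k hk1 hk2
    have hL' : Loaded n st fl s' := Loaded.of_frame
      ⟨by simp [hL.n], by simp [hL.st], by simp [hL.fl]⟩ hfr rfl rfl rfl
    have ev : s'.reg r_v = v := by rw [hfr.reg _ rfl]; simp [hv]
    have eM : s'.arr a_M = s.arr a_M := by rw [hfr.arr _ rfl]; simp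
    simp [hL'.fl, hik]
    intro _
    refine wp_conseq (wp_scanRow hN hW (x := fl k)
      ⟨by simp [hL'.n], by simp [hL'.st], by simp [hL'.fl]⟩
      (by simpa [IsMatrix, eM] using hM) hfl (by simp) hvn (by simp [ev])) ?_
    rintro t s1 - _ ⟨ht, h1⟩
    refine ⟨by omega, ?_⟩
    simp only [setReg_reg, ne_eq, Nat.reduceEqDiff, if_false] at h1 hI ⊢
    rw [h1, hI]
    constructor
    · rintro (⟨i, h2, h3, h4⟩ | h4)
      · exact ⟨i, h2, by omega, h4⟩
      · exact ⟨k, hk1, by omega, h4⟩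
    · rintro ⟨i, h2, h3, h4⟩
      by_cases hik' : i = k
      · subst hik'; exact Or.inr h4
      · exact Or.inl ⟨i, h2, by omega, h4⟩
  · rintro t s1 hfr _ ⟨ht, -, hI⟩
    simp at ht
    refine ⟨by nlinarith, hI.trans ⟨?_, ?_⟩⟩
    · rintro ⟨j, h1, h2, h3⟩; exact ⟨fl j, mem_nbrSet.2 ⟨j, h1, h2, rfl⟩, h3⟩
    · rintro ⟨y, hy, h3⟩
      obtain ⟨j, h1, h2, rfl⟩ := mem_nbrSet.1 hy
      exact ⟨j, h1, h2, h3⟩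

theorem wp_checkPair (hN : Net n st fl d D) (hW : (n + 2) ^ 4 < size w) (hL : Loaded n st fl s)
    (hM : IsMatrix n st fl s) {u v : ℕ} (hun : u < n) (hu : s.reg r_u = u) (hvn : v < n)
    (hv : s.reg r_v = v) (hne : u ≠ v) (hE : s.reg r_E ≤ D) :
    wp w checkPair s (fun t s' =>
      t ≤ (st (u + 1) - st u) * (30 * (st (v + 1) - st v) + 40) + 40 ∧
      s.reg r_E ≤ s'.reg r_E ∧ s'.reg r_E ≤ D ∧ (d u v ≤ 3 ∨ 4 ≤ s'.reg r_E)) := by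
  unfold checkPair
  rw [wp_seq]
  refine wp_conseq (wp_scanPair hN hW hL hM hun hu hvn hv) ?_
  rintro t s1 hf1 _ ⟨ht, hc⟩
  have eE : s1.reg r_E = s.reg r_E := hf1.reg _ rfl
  rw [← hN.dist_le_three_iff hun hvn hne] at hc
  have hD := hN.le_diam u hun v hvn
  have hsz : 4 < size w := by nlinarith [Nat.pow_le_pow_left (show 2 ≤ n + 2 by omega) 4]
  simp [eE]
  refine ⟨fun h0 _ => ⟨by omega, hE, ?_⟩, fun h0 => ⟨fun _ => hsz, fun hlt _ => ⟨hsz, ?_⟩,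
    fun hle _ => ?_⟩⟩
  · exact Or.inl (hc.1 h0)
  · have : ¬ d u v ≤ 3 := fun h => hc.2 h h0
    omega
  · omega

theorem wp_checkPairs (hN : Net n st fl d D) (hW : (n + 2) ^ 4 < size w) (hL : Loaded n st fl s)
    (hM : IsMatrix n st fl s) {S : ℕ} (hS : s.reg r_s = S) (hS0 : 0 < S) (hE : s.reg r_E ≤ D) :
    wp w checkPairs s (fun t s' => t ≤ 200 * (n * n * (S * S)) + 10 ∧
      s.reg r_E ≤ s'.reg r_E ∧ s'.reg r_E ≤ D ∧
      ∀ u < n, ∀ v < n, st (u + 1) - st u < S → st (v + 1) - st v < S →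
        d u v ≤ 3 ∨ 4 ≤ s'.reg r_E) := by
  unfold checkPairs degE
  simp
  refine fun hb0 => ⟨lt_size_of_le hW (by omega), ?_⟩
  refine wp_conseq (wp_forTo (I := fun k s' => s.reg r_E ≤ s'.reg r_E ∧ s'.reg r_E ≤ D ∧
      ∀ u < k, ∀ v < u, st (u + 1) - st u < S → st (v + 1) - st v < S →
        d u v ≤ 3 ∨ 4 ≤ s'.reg r_E)
    (T := fun u => 30 + n * (140 * (S * S)))
    (a := 0) (b := n) rfl rfl (by decide) (by simp) (by simp [hL.n]) (Nat.zero_le n) ?_ ?_) ?_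
  · simp [hE]
  · rintro u s' _ hfr _ hun hu _ ⟨h1, h2, h3⟩
    have hL' : Loaded n st fl s' := Loaded.of_frame
      ⟨by simp [hL.n], by simp [hL.st], by simp [hL.fl]⟩ hfr rfl rfl rfl
    have hS' : s'.reg r_s = S := by rw [hfr.reg _ rfl]; simp [hS]
    have eM : s'.arr a_M = s.arr a_M := by rw [hfr.arr _ rfl]; simp
    simp [hL'.st, hu, hS']
    refine ⟨fun _ => ⟨lt_size_of_le hW (by omega), lt_size_of_le hW (by omega)⟩,
      fun hlow _ => ⟨lt_size_of_le hW (by omega), ?_⟩, fun hhigh _ => ⟨by omega, h1, h2, ?_⟩⟩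
    · refine wp_conseq (wp_forTo (I := fun k s2 => s'.reg r_E ≤ s2.reg r_E ∧ s2.reg r_E ≤ D ∧
        ∀ v < k, st (v + 1) - st v < S → d u v ≤ 3 ∨ 4 ≤ s2.reg r_E)
        (T := fun v => 60 + 70 * (S * S))
        (a := 0) (b := u) rfl rfl (by decide) (by simp) (by simp [hu]) (Nat.zero_le u) ?_ ?_) ?_
      · simp [h2]
      · rintro v s2 _ hfr2 _ hvu hv hu2 ⟨h4, h5, h6⟩
        have hL2 : Loaded n st fl s2 := Loaded.of_frame
          ⟨by simp [hL'.n], by simp [hL'.st], by simp [hL'.fl]⟩ hfr2 rfl rfl rfl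
        have hS2 : s2.reg r_s = S := by rw [hfr2.reg _ rfl]; simp [hS']
        have hM2 : IsMatrix n st fl s2 := by
          have : s2.arr a_M = s.arr a_M := by rw [hfr2.arr _ rfl]; simp [eM]
          simpa [IsMatrix, this] using hM
        simp [hL2.st, hv, hS2]
        refine ⟨fun _ => ⟨lt_size_of_le hW (by omega), lt_size_of_le hW (by omega)⟩,
          fun hlow' => ?_, fun hhigh _ => ⟨by omega, h4, h5, fun v' hv' hlow' => ?_⟩⟩
        · refine wp_conseq (wp_checkPair hN hW hL2 hM2 hun hu2 (hvu.trans hun) hv (by omega) h5) ?_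
          rintro t s3 - _ ⟨ht, h7, h8, h9⟩
          refine ⟨?_, by simpa using h4.trans h7, by simpa using h8, fun v' hv' hlow'' => ?_⟩
          · have hm : (st (u + 1) - st u) * (30 * (st (v + 1) - st v) + 40) ≤ S * (70 * S) :=
              Nat.mul_le_mul hlow.le (by omega)
            have : S * (70 * S) = 70 * (S * S) := by ring
            omega
          · by_cases hvv : v' = v
            · subst hvv; simpa using h9
            · rcases h6 v' (by omega) hlow'' with h | h
              · exact Or.inl h
              · exact Or.inr (by simpa using h.trans h7)
        · by_cases hvv : v' = v
          · subst hvv; omega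
          · exact h6 v' (by omega) hlow'
      · rintro t s2 - _ ⟨ht, -, h4, h5, h6⟩
        simp at ht
        refine ⟨?_, by simpa using h1.trans h4, by simpa using h5, fun u' hu' v' hv' hlu hlv => ?_⟩
        · have hS1 : 1 ≤ S * S := Nat.mul_pos hS0 hS0
          have hm : u * (60 + 70 * (S * S) + 8) ≤ n * (140 * (S * S)) :=
            Nat.mul_le_mul hun.le (by omega)
          omega
        · by_cases huu : u' = u
          · subst huu; simpa using h6 v' hv' hlv
          · rcases h3 u' (by omega) v' hv' hlu hlv with h | h
            · exact Or.inl h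
            · exact Or.inr (by simpa using h.trans h4)
    · intro u' hu' v' hv' hlu hlv
      by_cases huu : u' = u
      · subst huu; omega
      · exact h3 u' (by omega) v' hv' hlu hlv
  · rintro t s1 hfr _ ⟨ht, -, h1, h2, h3⟩
    simp at ht
    refine ⟨?_, h1, h2, fun u hu v hv hlu hlv => ?_⟩
    · have hS1 : 1 ≤ S * S := Nat.mul_pos hS0 hS0
      have hn1 : n * (30 + n * (140 * (S * S)) + 8) ≤ n * (n * (S * S) * 180) := by
        refine Nat.mul_le_mul_left n ?_
        have := Nat.mul_pos hN.pos hS1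
        rw [show n * (140 * (S * S)) = 140 * (n * (S * S)) by ring]
        omega
      rw [show n * (n * (S * S) * 180) = 180 * (n * n * (S * S)) by ring] at hn1
      omega
    · rcases lt_trichotomy u v with h | rfl | h
      · rw [hN.dist_comm]; exact h3 v hv u h hlv hlu
      · left; rw [hN.dist_self u hu]; omega
      · exact h3 u hu v h hlu hlv

end
end WordRAM

/-! ### Distances with surplus two -/

section

variable {n : ℕ} {st fl : ℕ → ℕ} {d : ℕ → ℕ → ℕ} {D : ℕ}

/-- On a shortest path from `u` to `v`, take the last vertex of high degree: the detour through its
dominator costs at most two steps, and the rest of the path is searched exactly.  The labels are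
`val0` from the dominators, then `val1` after relaxing the edges into vertices of low degree, which
covers the edge of the path that leaves its last vertex of high degree, and finally `val` after
relaxing the edges out of vertices of low degree as long as possible. -/
theorem Net.label_le (hN : Net n st fl d D) {S : ℕ} {dom val0 val1 val : ℕ → ℕ}
    (hdom : ∀ x < n, S ≤ st (x + 1) - st x → ∃ b < n, dom x = b + 1 ∧ x ∈ nbrSet st fl b)
    {u : ℕ} (hun : u < n) (h0 : val0 u = 0)
    (h1 : ∀ v < n, ∀ b, dom v = b + 1 → val0 v ≤ d u b + 1)
    (h2 : ∀ v < n, val1 v ≤ val0 v ∧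
      (st (v + 1) - st v < S → ∀ x ∈ nbrSet st fl v, val1 v ≤ val0 x + 1))
    (h3 : ∀ v < n, val v ≤ val1 v)
    (h4 : ∀ v < n, st (v + 1) - st v < S → ∀ x ∈ nbrSet st fl v, val x ≤ val v + 1) :
    ∀ v < n, val v ≤ d u v + 2 := by
  have hhigh : ∀ z < n, S ≤ st (z + 1) - st z → val0 z ≤ d u z + 2 := by
    intro z hz hS
    obtain ⟨b, hbn, hb, hmem⟩ := hdom z hz hS
    have := h1 z hz b hb
    have := hN.dist_nbr_le hun hz (hN.nbrSet_comm hbn hmem).2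
    omega
  suffices H : ∀ k, ∀ v < n, d u v = k → val v ≤ k + 2 from fun v hv => H _ v hv rfl
  intro k
  induction k with
  | zero =>
    intro v hv hk
    obtain rfl := hN.eq_of_dist u hun v hv hk
    have := h3 u hun
    have := (h2 u hun).1
    omega
  | succ k ih =>
    intro v hv hk
    obtain ⟨y, hy, hyv, hvy, hd⟩ := hN.exists_nbrSet_pred hun hv (by omega)
    by_cases hvS : S ≤ st (v + 1) - st v
    · have := hhigh v hv hvS
      have := h3 v hv
      have := (h2 v hv).1
      omega
    · by_cases hyS : S ≤ st (y + 1) - st y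
      · -- the predecessor is the last vertex of high degree
        have := hhigh y hy hyS
        have := h3 v hv
        have := (h2 v hv).2 (by omega) y hyv
        omega
      · have := ih y hy (by omega)
        have := h4 y hy (by omega) v hvy
        omega

/-- The quality of the estimate.  A search from any vertex gives `E ≥ D / 2`, and surplus two gives
`E ≥ D - 2`.  This suffices unless `D` is `4` or `5`, where one more unit is needed: if an end of a
diametral pair has high degree, the search from its dominator gives `E ≥ D - 1`, and otherwise `E ≥
4`.  -/
theorem Net.estimate_ge (hN : Net n st fl d D) {S E : ℕ}
    (hdom : ∀ x < n, S ≤ st (x + 1) - st x → ∃ b < n, d x b ≤ 1 ∧ ∀ v < n, d b v ≤ E)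
    (hone : ∃ b < n, ∀ v < n, d b v ≤ E)
    (hlow : ∀ u < n, ∀ v < n, st (u + 1) - st u < S → st (v + 1) - st v < S →
      d u v ≤ 3 ∨ 4 ≤ E)
    (htwo : D ≤ E + 2) : 4 * D / 5 ≤ E := by
  obtain ⟨u, hu, v, hv, huv⟩ := hN.diam_attained
  obtain ⟨b, hb, hbE⟩ := hone
  have h1 : D ≤ 2 * E := by
    have := hN.triangle u hu v hv b hb
    have := hN.dist_comm u b
    have := hbE u hu
    have := hbE v hv
    omega
  have h2 : ∀ x < n, ∀ y < n, d x y = D → S ≤ st (x + 1) - st x → D ≤ E + 1 := by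
    intro x hx y hy hxy hxS
    obtain ⟨b, hb, hxb, hbE⟩ := hdom x hx hxS
    have := hN.triangle x hx y hy b hb
    have := hbE y hy
    omega
  by_cases huS : S ≤ st (u + 1) - st u
  · have := h2 u hu v hv huv huS
    omega
  by_cases hvS : S ≤ st (v + 1) - st v
  · have := h2 v hv u hu (by rw [hN.dist_comm]; exact huv) hvS
    omega
  rcases hlow u hu v hv (by omega) (by omega) with h | h <;> omega

end

namespace WordRAM

open WordRAM.Expr WordRAM.Program

/-- Label every vertex with an upper bound for its distance from `r_u`: one more than the distance
from `r_u` to its dominator, if it has one. -/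
def initLabels : Program :=
  r_c ≔ lit 0 ;;
  forTo r_c r_n
    (.store a_val (reg r_c) (reg r_n) ;;
     cond (cell a_dom (reg r_c))
      (.store a_val (reg r_c)
        (cell a_T ((cell a_dom (reg r_c) -ₑ lit 1) *ₑ reg r_n +ₑ reg r_u) +ₑ lit 1))
      skip) ;;
  .store a_val (reg r_u) (lit 0)

/-- Relax all edges into vertices of degree less than `r_s`, once. -/
def pullLabels : Program :=
  r_c ≔ lit 0 ;;
  forTo r_c r_n
    (cond (lt (degE (reg r_c)) (reg r_s))
      (r_j ≔ cell a_st (reg r_c) ;;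
       r_h ≔ cell a_st (reg r_c +ₑ lit 1) ;;
       forTo r_j r_h
        (r_x ≔ cell a_fl (reg r_j) ;;
         cond (lt (cell a_val (reg r_x) +ₑ lit 1) (cell a_val (reg r_c)))
          (.store a_val (reg r_c) (cell a_val (reg r_x) +ₑ lit 1)) skip))
      skip)

/-- Raise `r_E` to the maximum of the labels minus two. -/
def raiseEstimate : Program :=
  r_c ≔ lit 0 ;;
  forTo r_c r_n
    (cond (lt (reg r_E) (cell a_val (reg r_c) -ₑ lit 2))
      (r_E ≔ cell a_val (reg r_c) -ₑ lit 2) skip)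

/-- Estimate the distances from `r_u` with surplus at most two. -/
def surplusRow : Program :=
  initLabels ;; pullLabels ;; r_lim ≔ reg r_s ;; lowerLabels ;; raiseEstimate

/-- Estimate all distances with surplus at most two. -/
def surplusRows : Program := r_u ≔ lit 0 ;; forTo r_u r_n surplusRow

/-- The dominators are adjacent to the vertices they dominate, and their distances are known. -/
def HasDominators (n : ℕ) (st fl : ℕ → ℕ) (d : ℕ → ℕ → ℕ) (s : State) : Prop :=
  ∀ x < n, ∀ b, s.arr a_dom x = b + 1 → b < n ∧ x ∈ nbrSet st fl b ∧
    ∀ v < n, s.arr a_T (b * n + v) = d b v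

section

variable {w n : ℕ} {st fl : ℕ → ℕ} {d : ℕ → ℕ → ℕ} {D : ℕ} {s : State}

theorem wp_initLabels (hN : Net n st fl d D) (hW : (n + 2) ^ 4 < size w) (hL : Loaded n st fl s)
    (hd : HasDominators n st fl d s) {u : ℕ} (hun : u < n) (hu : s.reg r_u = u) :
    wp w initLabels s (fun t s' => t ≤ 40 * n + 20 ∧ s'.arr a_val u = 0 ∧
      ∀ v < n, d u v ≤ s'.arr a_val v ∧ s'.arr a_val v ≤ n ∧
        ∀ b, s.arr a_dom v = b + 1 → s'.arr a_val v ≤ d u b + 1) := by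
  unfold initLabels
  simp
  refine fun hb0 => ⟨lt_size_of_le hW (by omega), ?_⟩
  refine wp_conseq (wp_forTo (I := fun k s' => ∀ v < k, d u v ≤ s'.arr a_val v ∧
        s'.arr a_val v ≤ n ∧ ∀ b, s.arr a_dom v = b + 1 → s'.arr a_val v ≤ d u b + 1)
    (T := fun _ => 30)
    (a := 0) (b := n) rfl rfl (by decide) (by simp) (by simp [hL.n]) (Nat.zero_le n) ?_ ?_) ?_
  · simp
  · rintro k s' _ hfr _ hk hik hn' hI
    have eu : s'.reg r_u = u := by rw [hfr.reg _ rfl]; simp [hu]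
    have ed : s'.arr a_dom = s.arr a_dom := by rw [hfr.arr _ rfl]; simp
    have eT : s'.arr a_T = s.arr a_T := by rw [hfr.arr _ rfl]; simp
    have hlt := hN.dist_lt u hun k hk
    simp [hik, hn', eu, ed, eT]
    intro _
    refine ⟨fun h0 _ => ?_, fun h0 _ v hv => ?_⟩
    · obtain ⟨b, hb⟩ := Nat.exists_eq_succ_of_ne_zero h0
      obtain ⟨hbn, hmem, hrow⟩ := hd k hk b hb
      have hidx := index_lt hbn hun
      have hbu := hN.dist_lt b hbn u hun
      simp only [hb, Nat.succ_eq_add_one, Nat.add_sub_cancel, hrow u hun]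
      refine ⟨by and_intros <;> exact lt_size_of_le hW (by omega), fun v hv => ?_⟩
      by_cases hvk : v = k
      · subst hvk
        have := hN.dist_nbr_le hun hbn hmem
        have hc := hN.dist_comm b u
        simp only [Function.update_self]
        refine ⟨by omega, by omega, fun b' hb' => ?_⟩
        obtain rfl : b' = b := by omega
        omega
      · rw [Function.update_of_ne hvk]
        exact hI v (by omega)
    · by_cases hvk : v = k
      · subst hvk
        simp only [Function.update_self]
        exact ⟨by omega, le_rfl, fun b hb => by omega⟩
      · rw [Function.update_of_ne hvk]
        exact hI v (by omega)
  · rintro t s1 hfr _ ⟨ht, -, hI⟩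
    have eu : s1.reg r_u = u := by rw [hfr.reg _ rfl]; simp [hu]
    simp at ht
    simp [eu]
    refine fun _ => ⟨lt_size_of_le hW (by omega), by omega, fun v hv => ?_⟩
    by_cases hvu : v = u
    · subst hvu
      simp [hN.dist_self v hun]
    · rw [Function.update_of_ne hvu]
      exact hI v hv

theorem wp_pullLabels (hN : Net n st fl d D) (hW : (n + 2) ^ 4 < size w) (hL : Loaded n st fl s)
    {S : ℕ} (hS : s.reg r_s = S) {u : ℕ} (hun : u < n)
    (hval : ∀ v < n, d u v ≤ s.arr a_val v ∧ s.arr a_val v ≤ n) :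
    wp w pullLabels s (fun t s' => t ≤ n * (60 * S + 60) + 10 ∧
      ∀ v < n, d u v ≤ s'.arr a_val v ∧ s'.arr a_val v ≤ s.arr a_val v ∧
        (st (v + 1) - st v < S → ∀ x ∈ nbrSet st fl v, s'.arr a_val v ≤ s.arr a_val x + 1)) := by
  unfold pullLabels degE
  simp
  refine fun hb0 => ⟨lt_size_of_le hW (by omega), ?_⟩
  refine wp_conseq (wp_forTo (I := fun k s' => ∀ v < n, d u v ≤ s'.arr a_val v ∧
      s'.arr a_val v ≤ s.arr a_val v ∧ (v < k → st (v + 1) - st v < S →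
        ∀ x ∈ nbrSet st fl v, s'.arr a_val v ≤ s.arr a_val x + 1))
    (T := fun _ => 60 * S + 40)
    (a := 0) (b := n) rfl rfl (by decide) (by simp) (by simp [hL.n]) (Nat.zero_le n) ?_ ?_) ?_
  · simpa using fun v hv => (hval v hv).1
  · rintro c s' _ hfr _ hcn hc _ hI
    have hL' : Loaded n st fl s' := Loaded.of_frame
      ⟨by simp [hL.n], by simp [hL.st], by simp [hL.fl]⟩ hfr rfl rfl rfl
    have hS' : s'.reg r_s = S := by rw [hfr.reg _ rfl]; simp [hS]
    simp [hL'.st, hc, hS']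
    refine ⟨fun _ => ⟨lt_size_of_le hW (by omega), lt_size_of_le hW (by omega)⟩,
      fun hlow _ _ => ⟨⟨lt_size_of_le hW (by omega), lt_size_of_le hW (by omega)⟩, ?_⟩,
      fun hhigh _ v hv => ?_⟩
    · refine wp_conseq (wp_forTo (I := fun k s2 => (∀ v < n, v ≠ c →
          s2.arr a_val v = s'.arr a_val v) ∧ d u c ≤ s2.arr a_val c ∧
          s2.arr a_val c ≤ s'.arr a_val c ∧
          ∀ j, st c ≤ j → j < k → s2.arr a_val c ≤ s.arr a_val (fl j) + 1)
        (T := fun _ => 40)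
        (a := st c) (b := st (c + 1)) rfl rfl (by decide) (by simp) (by simp)
        (hN.mono c hcn) ?_ ?_) ?_
      · simp only [setReg_arr]
        exact ⟨fun _ _ _ => trivial, (hI c hcn).1, le_rfl, fun j h1 h2 => by omega⟩
      · rintro k s2 _ hfr2 hk1 hk2 hik _ ⟨h1, h2, h3, h4⟩
        have hfl := hN.fl_lt c hcn k hk1 hk2
        have ec : s2.reg r_c = c := by rw [hfr2.reg _ rfl]; simp [hc]
        have ef : s2.arr a_fl = fl := by rw [hfr2.arr _ rfl]; simp [hL'.fl]
        obtain ⟨j', hj1, hj2, hj3⟩ := hN.symm c hcn k hk1 hk2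
        have hstep := hN.dist_step u hun (fl k) hfl j' hj1 hj2
        rw [hj3] at hstep
        have hx2 : d u (fl k) ≤ s2.arr a_val (fl k) ∧
            s2.arr a_val (fl k) ≤ s.arr a_val (fl k) := by
          by_cases hkc : fl k = c
          · rw [hkc]; exact ⟨h2, h3.trans (hI c hcn).2.1⟩
          · rw [h1 _ hfl hkc]; exact ⟨(hI _ hfl).1, (hI _ hfl).2.1⟩
        have hxn := (hval _ hfl).2
        simp [hik, ec, ef]
        refine fun _ => ⟨fun _ => ⟨lt_size_of_le hW (by omega), lt_size_of_le hW (by omega)⟩,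
          fun hlt _ => ⟨⟨lt_size_of_le hW (by omega), lt_size_of_le hW (by omega)⟩, ?_⟩,
          fun hle _ => ⟨h1, h2, h3, fun j hj1 hj2 => ?_⟩⟩
        · refine ⟨fun v hv hvc => ?_, by omega, by omega, fun j hj1 hj2 => ?_⟩
          · rw [Function.update_of_ne hvc]; exact h1 v hv hvc
          · by_cases hjk : j = k
            · rw [hjk]; omega
            · have := h4 j hj1 (by omega); omega
        · by_cases hjk : j = k
          · rw [hjk]; omega
          · exact h4 j hj1 (by omega)
      · rintro t s2 _ _ ⟨ht, -, h1, h2, h3, h4⟩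
        simp at ht
        refine ⟨by omega, fun v hv => ?_⟩
        by_cases hvc : v = c
        · subst hvc
          refine ⟨by simpa using h2, by simpa using h3.trans (hI v hv).2.1, fun _ _ x hx => ?_⟩
          obtain ⟨j, hj1, hj2, rfl⟩ := mem_nbrSet.1 hx
          simpa using h4 j hj1 hj2
        · simp only [h1 v hv hvc]
          exact ⟨(hI v hv).1, (hI v hv).2.1, fun hlt => (hI v hv).2.2 (by omega)⟩
    · refine ⟨(hI v hv).1, (hI v hv).2.1, fun hlt hlow => ?_⟩
      by_cases hvc : v = c
      · subst hvc; omega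
      · exact (hI v hv).2.2 (by omega) hlow
  · rintro t s1 hfr _ ⟨ht, -, hI⟩
    simp at ht
    exact ⟨by nlinarith, fun v hv => ⟨(hI v hv).1, (hI v hv).2.1, (hI v hv).2.2 hv⟩⟩

theorem wp_raiseEstimate (hW : (n + 2) ^ 4 < size w) (hn : s.reg r_n = n) {D' : ℕ}
    (hE : s.reg r_E ≤ D') (hval : ∀ v < n, s.arr a_val v ≤ D' + 2) :
    wp w raiseEstimate s (fun t s' => t ≤ 30 * n + 10 ∧ s.reg r_E ≤ s'.reg r_E ∧
      s'.reg r_E ≤ D' ∧ ∀ v < n, s.arr a_val v ≤ s'.reg r_E + 2) := by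
  unfold raiseEstimate
  simp
  refine fun hb0 => ⟨lt_size_of_le hW (by omega), ?_⟩
  refine wp_conseq (wp_forTo (I := fun k s' => s.reg r_E ≤ s'.reg r_E ∧ s'.reg r_E ≤ D' ∧
      ∀ v < k, s.arr a_val v ≤ s'.reg r_E + 2) (T := fun _ => 20)
    (a := 0) (b := n) rfl rfl (by decide) (by simp) (by simp [hn]) (Nat.zero_le n) ?_ ?_) ?_
  · simp [hE]
  · rintro k s' _ hfr _ hk hik _ ⟨h1, h2, h3⟩
    have ev : s'.arr a_val = s.arr a_val := by rw [hfr.arr _ rfl]; simp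
    have hvk := hval k hk
    simp [hik, ev]
    refine ⟨fun _ => lt_size_of_le hW (by omega), fun hlt _ => ⟨lt_size_of_le hW (by omega),
      by omega, by omega, fun v hv => ?_⟩, fun hle _ => ⟨h1, h2, fun v hv => ?_⟩⟩
    · by_cases hvk : v = k
      · subst hvk; omega
      · have := h3 v (by omega); omega
    · by_cases hvk : v = k
      · subst hvk; omega
      · exact h3 v (by omega)
  · rintro t s1 hfr _ ⟨ht, -, hI⟩
    simp at ht
    exact ⟨by omega, hI⟩

theorem sum_scanCost_le_mul (S : ℕ) :
    ∑ v ∈ Finset.range n, scanCost st S v ≤ n * S := by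
  calc _ ≤ ∑ v ∈ Finset.range n, S :=
        Finset.sum_le_sum fun v _ => by unfold scanCost; split <;> omega
    _ = n * S := by simp

theorem wp_surplusRow (hN : Net n st fl d D) (hW : (n + 2) ^ 4 < size w) (hL : Loaded n st fl s)
    {S : ℕ} (hS : s.reg r_s = S) (hS0 : 0 < S) (hd : HasDominators n st fl d s)
    (hdom : needy n st S (s.arr a_dom) = ∅)
    {u : ℕ} (hun : u < n) (hu : s.reg r_u = u) (hcnt : ∀ k, s.arr a_cnt k = 0)
    (hE : s.reg r_E ≤ D) :
    wp w surplusRow s (fun t s' => t ≤ 1500 * (n * S) ∧ (∀ k, s'.arr a_cnt k = 0) ∧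
      s.reg r_E ≤ s'.reg r_E ∧ s'.reg r_E ≤ D ∧ ∀ v < n, d u v ≤ s'.reg r_E + 2) := by
  unfold surplusRow
  rw [wp_seq]
  refine wp_conseq (wp_initLabels hN hW hL hd hun hu) ?_
  rintro t1 s1 hf1 - ⟨ht1, hv1, h1⟩
  have hL1 := hL.of_frame hf1 rfl rfl rfl
  have hS1 : s1.reg r_s = S := (hf1.reg _ rfl).trans hS
  rw [wp_seq]
  refine wp_conseq (wp_pullLabels hN hW hL1 hS1 hun (fun v hv => ⟨(h1 v hv).1, (h1 v hv).2.1⟩)) ?_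
  rintro t2 s2 hf2 - ⟨ht2, h2⟩
  have hL2 := hL1.of_frame hf2 rfl rfl rfl
  have hS2 : s2.reg r_s = S := (hf2.reg _ rfl).trans hS1
  have hcnt2 : ∀ k, s2.arr a_cnt k = 0 := by
    rw [hf2.arr _ rfl, hf1.arr _ rfl]; exact hcnt
  rw [wp_seq, wp_assign]
  refine fun _ => ⟨trivial, ?_⟩
  rw [wp_seq]
  refine wp_conseq (wp_lowerLabels (lim := S) (g := d u) hN.toCsr hW
      ⟨by simp [hL2.n], by simp [hL2.st], by simp [hL2.fl]⟩ (by simp [hS2]) ?_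
      (by simpa using hcnt2) ?_ ?_) ?_
  · intro v hv
    have := (h1 v hv).2.1
    have := (h2 v hv).2.1
    simp; omega
  · intro v hv
    simpa using (h2 v hv).1
  · exact fun v hv j hj hj' => hN.dist_step u hun v hv j hj hj'
  · rintro t3 s3 hf3 - ⟨ht3, hcnt3, hle3, hge3, hcl3⟩
    simp only [setReg_arr] at hle3
    have hlab : ∀ v < n, s3.arr a_val v ≤ d u v + 2 := by
      refine hN.label_le (S := S) (dom := s.arr a_dom) (val0 := s1.arr a_val)
        (val1 := s2.arr a_val) ?_ hun hv1 (fun v hv => (h1 v hv).2.2) (fun v hv => (h2 v hv).2)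
        hle3 ?_
      · intro x hx hxS
        have hne : s.arr a_dom x ≠ 0 := by
          intro h0
          have : x ∈ needy n st S (s.arr a_dom) := by
            simp only [needy, Finset.mem_filter, Finset.mem_range]
            exact ⟨hx, h0, hxS⟩
          rw [hdom] at this
          simp at this
        obtain ⟨b, hb⟩ := Nat.exists_eq_succ_of_ne_zero hne
        obtain ⟨hbn, hmem, -⟩ := hd x hx b hb
        exact ⟨b, hbn, hb, hmem⟩
      · intro v hv hlow x hx
        obtain ⟨j, hj1, hj2, rfl⟩ := mem_nbrSet.1 hx
        exact hcl3 v hv hlow j hj1 hj2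
    have eE : s3.reg r_E = s.reg r_E := by
      rw [hf3.reg _ rfl, setReg_reg, if_neg (by decide), hf2.reg _ rfl, hf1.reg _ rfl]
    have en : s3.reg r_n = n := by
      rw [hf3.reg _ rfl, setReg_reg, if_neg (by decide), hL2.n]
    refine wp_conseq (wp_raiseEstimate hW en (D' := D) (by rw [eE]; exact hE) ?_) ?_
    · intro v hv
      have := hlab v hv
      have := hN.le_diam u hun v hv
      omega
    · rintro t4 s4 hf4 - ⟨ht4, h5, h6, h7⟩
      refine ⟨?_, ?_, by rw [← eE]; exact h5, h6, fun v hv => (hge3 v hv).trans (h7 v hv)⟩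
      · have := sum_scanCost_le_mul (n := n) (st := st) S
        have h8 : n * 1 ≤ n * S := Nat.mul_le_mul_left n hS0
        have h9 := hN.pos
        have h10 : n * (60 * S + 60) = 60 * (n * S) + 60 * n := by ring
        simp only [Expr.cost]
        omega
      · rw [hf4.arr _ rfl]; exact hcnt3

/-- The labels lie between the distances and the distances plus two, so `r_E`, their maximum minus
two, ends up between `D - 2` and `D`. -/
theorem wp_surplusRows (hN : Net n st fl d D) (hW : (n + 2) ^ 4 < size w) (hL : Loaded n st fl s)
    {S : ℕ} (hS : s.reg r_s = S) (hS0 : 0 < S) (hd : HasDominators n st fl d s)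
    (hdom : needy n st S (s.arr a_dom) = ∅) (hcnt : ∀ k, s.arr a_cnt k = 0)
    (hE : s.reg r_E ≤ D) :
    wp w surplusRows s (fun t s' => t ≤ 1520 * (n * n * S) ∧
      s.reg r_E ≤ s'.reg r_E ∧ s'.reg r_E ≤ D ∧ D ≤ s'.reg r_E + 2) := by
  unfold surplusRows
  simp
  refine fun hb0 => ⟨lt_size_of_le hW (by omega), ?_⟩
  refine wp_conseq (wp_forTo (I := fun k s' => (∀ k, s'.arr a_cnt k = 0) ∧
      s.reg r_E ≤ s'.reg r_E ∧ s'.reg r_E ≤ D ∧ ∀ u < k, ∀ v < n, d u v ≤ s'.reg r_E + 2)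
    (T := fun _ => 1500 * (n * S))
    (a := 0) (b := n) rfl rfl (by decide) (by simp) (by simp [hL.n]) (Nat.zero_le n) ?_ ?_) ?_
  · simpa [hE] using hcnt
  · rintro k s' _ hfr _ hk hik _ ⟨h1, h2, h3, h4⟩
    have hL' : Loaded n st fl s' := Loaded.of_frame
      ⟨by simp [hL.n], by simp [hL.st], by simp [hL.fl]⟩ hfr rfl rfl rfl
    have hS' : s'.reg r_s = S := by rw [hfr.reg _ rfl]; simp [hS]
    have ed : s'.arr a_dom = s.arr a_dom := by rw [hfr.arr _ rfl]; simp
    have eT : s'.arr a_T = s.arr a_T := by rw [hfr.arr _ rfl]; simp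
    refine wp_conseq (wp_surplusRow hN hW hL' hS' hS0
      (by simpa only [HasDominators, ed, eT] using hd) (by rw [ed]; exact hdom) hk hik h1 h3) ?_
    rintro t s1 - _ ⟨ht, h5, h6, h7, h8⟩
    refine ⟨ht, by simpa using h5, by simpa using h2.trans h6, by simpa using h7,
      fun u hu v hv => ?_⟩
    by_cases huk : u = k
    · subst huk; simpa using h8 v hv
    · have := h4 u (by omega) v hv
      simp; omega
  · rintro t s1 hfr _ ⟨ht, -, h1, h2, h3, h4⟩
    simp at ht
    refine ⟨?_, h2, h3, ?_⟩
    · have h8 : n * 1 ≤ n * S := Nat.mul_le_mul_left n hS0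
      have h9 := hN.pos
      have h10 : n * (1500 * (n * S) + 8) ≤ n * (1508 * (n * S)) := Nat.mul_le_mul_left n (by omega)
      have h11 : n * (1508 * (n * S)) = 1508 * (n * n * S) := by ring
      have h12 : 1 * 1 ≤ n * (n * S) := Nat.mul_le_mul (by omega) (by omega)
      have h13 : n * (n * S) = n * n * S := by ring
      omega
    · obtain ⟨u, hu, v, hv, h⟩ := hN.diam_attained
      have := h4 u hu v hv
      omega

end

/-! ### The algorithm -/

/-- Find the degree threshold `r_s`: the least positive number whose cube is at least the average
degree. -/
def findThreshold : Program :=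
  r_s ≔ lit 1 ;;
  loop (lt (reg r_n *ₑ reg r_s *ₑ reg r_s *ₑ reg r_s) (cell a_st (reg r_n)))
    (r_s ≔ reg r_s +ₑ lit 1)

/-- The approximation algorithm for the diameter. -/
def diameterEstimate : Program :=
  findThreshold ;; greedy ;; buildMatrix ;; checkPairs ;; surplusRows ;; r_n ≔ reg r_E

section

variable {w n : ℕ} {st fl : ℕ → ℕ} {d : ℕ → ℕ → ℕ} {D : ℕ} {s : State}

theorem wp_findThreshold (hC : Csr n st fl) (hW : (n + 2) ^ 4 < size w) (hL : Loaded n st fl s) :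
    wp w findThreshold s (fun t s' => t ≤ 30 * n + 30 ∧ 0 < s'.reg r_s ∧ s'.reg r_s ≤ n ∧
      st n ≤ n * s'.reg r_s ^ 3 ∧ (s'.reg r_s = 1 ∨ n * (s'.reg r_s - 1) ^ 3 < st n)) := by
  have hpos := hC.pos
  have hst := hC.le n le_rfl
  unfold findThreshold
  rw [wp_seq, wp_assign]
  refine fun _ => ⟨lt_size_of_le hW (by omega), ?_⟩
  refine wp_conseq (wp_loop (Φ := fun s' => 30 * (n - s'.reg r_s))
    (I := fun s' => 0 < s'.reg r_s ∧ s'.reg r_s ≤ n ∧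
      (s'.reg r_s = 1 ∨ n * (s'.reg r_s - 1) ^ 3 < st n)) ?_ ?_ ?_) ?_
  · rintro s' hf ⟨h1, h2, -⟩
    have en : s'.reg r_n = n := by rw [hf.reg _ rfl]; simp [hL.n]
    have h3 : n * s'.reg r_s ≤ n * n := Nat.mul_le_mul_left n h2
    have h4 : n * s'.reg r_s * s'.reg r_s ≤ n * n * n := Nat.mul_le_mul h3 h2
    have h5 : n * s'.reg r_s * s'.reg r_s * s'.reg r_s ≤ n * n * n * n := Nat.mul_le_mul h4 h2
    have h6 : n * n * n * n < (n + 2) ^ 4 := by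
      have := Nat.pow_lt_pow_left (show n < n + 2 by omega) (show 4 ≠ 0 by omega)
      calc _ = n ^ 4 := by ring
        _ < _ := this
    have h7 : n * n * n ≤ n * n * n * n := Nat.le_mul_of_pos_right _ hpos
    simp [en]
    refine ⟨⟨lt_size_of_le hW (by omega), by omega⟩, by omega⟩
  · rintro s' _ hf ⟨h1, h2, h3⟩ hg
    have hL' : Loaded n st fl s' := Loaded.of_frame
      ⟨by simp [hL.n], by simp [hL.st], by simp [hL.fl]⟩ hf rfl rfl rfl
    simp [hL'.n, hL'.st] at hg
    have h4 : s'.reg r_s < n := by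
      by_contra hc
      have h5 : s'.reg r_s = n := by omega
      rw [h5] at hg
      have h6 : n * n * 1 ≤ n * n * (n * n) := Nat.mul_le_mul_left _ (Nat.mul_pos hpos hpos)
      have h7 : n * n * (n * n) = n * n * n * n := by ring
      omega
    simp
    refine fun _ => ⟨⟨lt_size_of_le hW (by omega), lt_size_of_le hW (by omega)⟩, ⟨by omega, ?_⟩,
      by omega⟩
    right
    calc _ = n * s'.reg r_s * s'.reg r_s * s'.reg r_s := by ring
      _ < _ := hg
  · simp; omega
  · rintro t s' hf - ⟨⟨h1, h2, h3⟩, hg, ht⟩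
    have hL' : Loaded n st fl s' := Loaded.of_frame
      ⟨by simp [hL.n], by simp [hL.st], by simp [hL.fl]⟩ hf rfl rfl rfl
    simp [hL'.n, hL'.st] at hg
    simp at ht
    refine ⟨by simp; omega, h1, h2, ?_, h3⟩
    calc _ ≤ _ := hg
      _ = _ := by ring

/-- The algorithm on the adjacency lists of a connected graph.  The time is stated in terms of
the degree threshold `S`. -/
theorem wp_diameterEstimate (hN : Net n st fl d D) (hW : (n + 2) ^ 4 < size w)
    (hL : Loaded n st fl s) (hreg : s.reg r_E = 0)
    (harr : ∀ a, a ≠ a_st → a ≠ a_fl → ∀ i, s.arr a i = 0) :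
    wp w diameterEstimate s (fun t s' => 4 * D / 5 ≤ s'.reg r_n ∧ s'.reg r_n ≤ D ∧
      ∃ S, 0 < S ∧ S ≤ n ∧ st n ≤ n * S ^ 3 ∧ (S = 1 ∨ n * (S - 1) ^ 3 < st n) ∧
        t ≤ 4000 * ((n + st n) * (roundBound (n / S + 1) n + 1) + n * n * (S * S))) := by
  have hpos := hN.pos
  unfold diameterEstimate
  rw [wp_seq]
  refine wp_conseq (wp_findThreshold hN.toCsr hW hL) ?_
  rintro t1 s1 hf1 - ⟨ht1, hS0, hSn, hS3, hS4⟩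
  obtain ⟨S, hS1⟩ : ∃ S, s1.reg r_s = S := ⟨_, rfl⟩
  rw [hS1] at hS0 hSn hS3 hS4
  have hL1 := hL.of_frame hf1 rfl rfl rfl
  have hq : n ≤ (n / S + 1) * S := by
    have := Nat.lt_div_mul_add (a := n) hS0
    rw [Nat.add_mul]; omega
  rw [wp_seq]
  refine wp_conseq (wp_greedy hN hW hL1 hS1 hS0 hq
    (by rw [hf1.arr _ rfl]; exact harr _ (by decide) (by decide))
    (by rw [hf1.arr _ rfl]; exact harr _ (by decide) (by decide))
    (by rw [hf1.reg _ rfl]; exact hreg)) ?_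
  rintro t2 s2 hf2 - ⟨ht2, hG, hbc⟩
  have hL2 := hL1.of_frame hf2 rfl rfl rfl
  have hS2 : s2.reg r_s = S := (hf2.reg _ rfl).trans hS1
  obtain ⟨hneedy, hone⟩ := hG.final hbc
  rw [wp_seq]
  refine wp_conseq (wp_buildMatrix hN hW hL2
    (by rw [hf2.arr _ rfl, hf1.arr _ rfl]; exact harr _ (by decide) (by decide))) ?_
  rintro t3 s3 hf3 - ⟨ht3, hM⟩
  have hL3 := hL2.of_frame hf3 rfl rfl rfl
  have hS3' : s3.reg r_s = S := (hf3.reg _ rfl).trans hS2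
  have hE3 : s3.reg r_E = s2.reg r_E := hf3.reg _ rfl
  rw [wp_seq]
  refine wp_conseq (wp_checkPairs hN hW hL3 hM hS3' hS0 (by rw [hE3]; exact hG.le_diam)) ?_
  rintro t4 s4 hf4 - ⟨ht4, hE4, hD4, hlow⟩
  have hL4 := hL3.of_frame hf4 rfl rfl rfl
  have hS4' : s4.reg r_s = S := (hf4.reg _ rfl).trans hS3'
  have ed : s4.arr a_dom = s2.arr a_dom := (hf4.arr _ rfl).trans (hf3.arr _ rfl)
  have eT : s4.arr a_T = s2.arr a_T := (hf4.arr _ rfl).trans (hf3.arr _ rfl)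
  have ec : s4.arr a_cnt = s2.arr a_cnt := (hf4.arr _ rfl).trans (hf3.arr _ rfl)
  rw [wp_seq]
  refine wp_conseq (wp_surplusRows hN hW hL4 hS4' hS0 ?_ (by rw [ed]; exact hneedy)
    (by rw [ec]; exact hG.cnt) hD4) ?_
  · intro x hx b hb
    rw [ed] at hb
    obtain ⟨h1, h2, h3⟩ := hG.dom x hx b hb
    exact ⟨h1, h2, fun v hv => by rw [eT]; exact (h3 v hv).1⟩
  rintro t5 s5 hf5 - ⟨ht5, hE5, hD5, htwo⟩
  rw [wp_assign]
  refine fun _ => ⟨trivial, ?_⟩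
  have hE : s2.reg r_E ≤ s5.reg r_E := by omega
  simp only [Expr.eval, Expr.cost, setReg_reg, if_true]
  refine ⟨hN.estimate_ge (S := S) ?_ ?_ ?_ htwo, hD5, S, hS0, hSn, hS3, hS4, ?_⟩
  · intro x hx hxS
    have hne : s2.arr a_dom x ≠ 0 := by
      intro h0
      have : x ∈ needy n st S (s2.arr a_dom) := by
        simp only [needy, Finset.mem_filter, Finset.mem_range]
        exact ⟨hx, h0, hxS⟩
      rw [hneedy] at this
      simp at this
    obtain ⟨b, hb⟩ := Nat.exists_eq_succ_of_ne_zero hne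
    obtain ⟨hbn, hmem, hrow⟩ := hG.dom x hx b hb
    refine ⟨b, hbn, ?_, fun v hv => (hrow v hv).2.trans hE⟩
    have := hN.dist_nbr_le hx hx (hN.nbrSet_comm hbn hmem).2
    rwa [hN.dist_self x hx] at this
  · obtain ⟨b, hb, hbE⟩ := hone
    exact ⟨b, hb, fun v hv => (hbE v hv).trans hE⟩
  · intro u hu v hv h1 h2
    rcases hlow u hu v hv h1 h2 with h | h <;> omega
  · obtain ⟨r, hr⟩ : ∃ r, roundBound (n / S + 1) n = r := ⟨_, rfl⟩
    rw [hr] at ht2 ⊢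
    have h1 : (n + 1 + st n) * (r + 2) ≤ 2 * (n + st n) * (2 * (r + 1)) :=
      Nat.mul_le_mul (by omega) (by omega)
    have h2 : 2 * (n + st n) * (2 * (r + 1)) = 4 * ((n + st n) * (r + 1)) := by ring
    have h3 : 700 * (n + 1 + st n) * (r + 2) = 700 * ((n + 1 + st n) * (r + 2)) := by ring
    have h4 : (n + st n) * 1 ≤ (n + st n) * (r + 1) := Nat.mul_le_mul_left _ (by omega)
    have h5 : n * n * (S * 1) ≤ n * n * (S * S) :=
      Nat.mul_le_mul_left _ (Nat.mul_le_mul_left _ hS0)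
    rw [Nat.mul_one] at h5
    omega

end
end WordRAM

/-! ### Adjacency lists of simple graphs -/

namespace AdjacencyLists

variable {n : ℕ} {G : SimpleGraph (Fin n)}

theorem start_zero (L : AdjacencyLists G) : L.start 0 = 0 := by simp [start]

theorem start_succ (L : AdjacencyLists G) {y : ℕ} (hy : y < n) :
    L.start (y + 1) = L.start y + (L.nbrs ⟨y, hy⟩).length := by
  have h : y < (List.ofFn L.nbrs).length := by simpa using hy
  simp [start, List.take_add_one, List.getElem?_eq_getElem h, List.getElem_ofFn]

theorem start_eq_sum (L : AdjacencyLists G) : L.start n = ∑ u, (L.nbrs u).length := by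
  simp [start, List.take_of_length_le, List.map_ofFn, List.sum_ofFn]

theorem flat_getD (L : AdjacencyLists G) {y : ℕ} (hy : y < n) {k : ℕ}
    (hk : k < (L.nbrs ⟨y, hy⟩).length) :
    L.flat.getD (L.start y + k) 0 = ((L.nbrs ⟨y, hy⟩)[k] : ℕ) := by
  have h : y < (List.ofFn L.nbrs).length := by simpa using hy
  have h1 := List.drop_take_succ_flatten_eq_getElem (List.ofFn L.nbrs) y h
  have h2 := L.start_succ hy
  have h3 : (List.ofFn L.nbrs)[y] = L.nbrs ⟨y, hy⟩ := by simp
  rw [h3] at h1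
  have h4 : ((((List.ofFn L.nbrs).flatten.take (L.start (y + 1))).drop (L.start y)))[k]? =
      some ((L.nbrs ⟨y, hy⟩)[k]) := by
    have h5 : ((List.ofFn L.nbrs).flatten.take (L.start (y + 1))).drop (L.start y) =
      L.nbrs ⟨y, hy⟩ := by rw [← h1]; simp [start, List.map_take]
    rw [h5, List.getElem?_eq_getElem hk]
  rw [List.getElem?_drop, List.getElem?_take_of_lt (by omega)] at h4
  rw [flat, List.getD_eq_getElem?_getD, List.getElem?_map, h4]
  rfl

theorem length_nbrs (L : AdjacencyLists G) [DecidableRel G.Adj] (u : Fin n) :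
    (L.nbrs u).length = G.degree u := by
  classical
  rw [← List.toFinset_card_of_nodup (L.nodup u), ← SimpleGraph.card_neighborFinset_eq_degree]
  congr 1
  ext v
  simp [L.mem_nbrs]

theorem start_eq_two_mul (L : AdjacencyLists G) : L.start n = 2 * G.edgeSet.ncard := by
  classical
  rw [start_eq_sum, Finset.sum_congr rfl fun u _ => L.length_nbrs u,
    SimpleGraph.sum_degrees_eq_twice_card_edges, ← SimpleGraph.coe_edgeFinset,
    Set.ncard_coe_finset]

end AdjacencyLists

/-- The distance in `G`, as a function on natural numbers, zero outside the vertices. -/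
noncomputable def natDist {n : ℕ} (G : SimpleGraph (Fin n)) (u v : ℕ) : ℕ :=
  if h : u < n ∧ v < n then G.dist ⟨u, h.1⟩ ⟨v, h.2⟩ else 0

namespace AdjacencyLists

variable {n : ℕ} {G : SimpleGraph (Fin n)}

theorem input_st (L : AdjacencyLists G) {y : ℕ} (hy : y ≤ n) :
    L.input.arr a_st y = L.start y := by simp [input, hy]

theorem input_fl (L : AdjacencyLists G) (j : ℕ) : L.input.arr a_fl j = L.flat.getD j 0 := by
  simp [input]

theorem input_deg (L : AdjacencyLists G) {y : ℕ} (hy : y < n) :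
    L.input.arr a_st (y + 1) = L.input.arr a_st y + (L.nbrs ⟨y, hy⟩).length := by
  rw [L.input_st hy.le, L.input_st hy, L.start_succ hy]

theorem exists_entry (L : AdjacencyLists G) {y : ℕ} (hy : y < n) {j : ℕ}
    (h1 : L.input.arr a_st y ≤ j) (h2 : j < L.input.arr a_st (y + 1)) :
    ∃ (k : ℕ) (hk : k < (L.nbrs ⟨y, hy⟩).length), j = L.input.arr a_st y + k ∧
      L.input.arr a_fl j = ((L.nbrs ⟨y, hy⟩)[k] : ℕ) := by
  rw [L.input_deg hy] at h2
  obtain ⟨k, rfl⟩ := Nat.exists_eq_add_of_le h1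
  have hk : k < (L.nbrs ⟨y, hy⟩).length := by omega
  refine ⟨k, hk, rfl, ?_⟩
  rw [L.input_fl, L.input_st hy.le, L.flat_getD hy hk]

theorem exists_position_iff (L : AdjacencyLists G) {y x : ℕ} (hy : y < n) (hx : x < n) :
    (∃ j, L.input.arr a_st y ≤ j ∧ j < L.input.arr a_st (y + 1) ∧ L.input.arr a_fl j = x) ↔
      G.Adj ⟨y, hy⟩ ⟨x, hx⟩ := by
  rw [← L.mem_nbrs]
  constructor
  · rintro ⟨j, h1, h2, rfl⟩
    obtain ⟨k, hk, -, h⟩ := L.exists_entry hy h1 h2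
    simp only [h]
    exact List.getElem_mem hk
  · intro h
    obtain ⟨k, hk, h⟩ := List.getElem_of_mem h
    refine ⟨L.input.arr a_st y + k, by omega, by rw [L.input_deg hy]; omega, ?_⟩
    rw [L.input_fl, L.input_st hy.le, L.flat_getD hy hk, h]

theorem net (L : AdjacencyLists G) (hG : G.Connected) :
    Net n (L.input.arr a_st) (L.input.arr a_fl) (natDist G) G.diam := by
  classical
  have hne : Nonempty (Fin n) := hG.nonempty
  have hpos : 0 < n := Fin.pos_iff_nonempty.2 hne
  have hlt : ∀ y < n, ∀ j, L.input.arr a_st y ≤ j → j < L.input.arr a_st (y + 1) →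
      L.input.arr a_fl j < n := by
    intro y hy j h1 h2
    obtain ⟨k, hk, -, h⟩ := L.exists_entry hy h1 h2
    rw [h]; exact Fin.is_lt _
  have hdeg : ∀ y (hy : y < n), (L.nbrs ⟨y, hy⟩).length < n := by
    intro y hy
    rw [L.length_nbrs]
    simpa using G.degree_lt_card_verts ⟨y, hy⟩
  have hadj : ∀ y (hy : y < n) j (h1 : L.input.arr a_st y ≤ j)
      (h2 : j < L.input.arr a_st (y + 1)),
      G.Adj ⟨y, hy⟩ ⟨L.input.arr a_fl j, hlt y hy j h1 h2⟩ := fun y hy j h1 h2 =>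
    (L.exists_position_iff hy (hlt y hy j h1 h2)).1 ⟨j, h1, h2, rfl⟩
  have hd : ∀ u (hu : u < n) v (hv : v < n), natDist G u v = G.dist ⟨u, hu⟩ ⟨v, hv⟩ :=
    fun u hu v hv => dif_pos ⟨hu, hv⟩
  have htop : G.ediam ≠ ⊤ := SimpleGraph.connected_iff_ediam_ne_top.1 hG
  constructor
  · refine ⟨hpos, fun y hy => by rw [L.input_deg hy]; omega, fun y hy => ?_, hlt⟩
    have key : ∀ y ≤ n, L.input.arr a_st y ≤ y * n := by
      intro y
      induction y with
      | zero => intro _; rw [L.input_st (Nat.zero_le n), L.start_zero]; simp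
      | succ y ih =>
        intro hy
        rw [L.input_deg hy, Nat.succ_mul]
        exact Nat.add_le_add (ih (by omega)) (hdeg y hy).le
    exact (key y hy).trans (Nat.mul_le_mul_right n hy)
  · intro y hy
    rw [L.input_deg hy, Nat.add_sub_cancel_left]
    exact hdeg y hy
  · intro y hy j h1 h2 j' h1' h2' he
    obtain ⟨k, hk, rfl, h⟩ := L.exists_entry hy h1 h2
    obtain ⟨k', hk', rfl, h'⟩ := L.exists_entry hy h1' h2'
    rw [h, h'] at he
    rw [(L.nodup ⟨y, hy⟩).getElem_inj_iff.1 (Fin.ext he)]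
  · intro y hy j h1 h2
    exact (L.exists_position_iff (hlt y hy j h1 h2) hy).2 (hadj y hy j h1 h2).symm
  · intro u hu
    rw [hd u hu u hu, SimpleGraph.dist_self]
  · intro u v
    unfold natDist
    by_cases h : u < n ∧ v < n
    · rw [dif_pos h, dif_pos h.symm, SimpleGraph.dist_comm]
    · rw [dif_neg h, dif_neg fun h' => h h'.symm]
  · intro u hu v hv
    obtain ⟨p, hp, hl⟩ := hG.exists_path_of_dist ⟨u, hu⟩ ⟨v, hv⟩
    rw [hd u hu v hv, ← hl]
    simpa using hp.length_lt
  · intro u hu v hv h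
    rw [hd u hu v hv, hG.dist_eq_zero_iff] at h
    simpa using h
  · intro u hu y hy j h1 h2
    rw [hd u hu _ (hlt y hy j h1 h2), hd u hu y hy]
    refine (hG.dist_triangle (v := ⟨y, hy⟩)).trans ?_
    rw [SimpleGraph.dist_eq_one_iff_adj.2 (hadj y hy j h1 h2)]
  · intro u hu v hv h
    rw [hd u hu v hv, SimpleGraph.dist_comm] at h
    obtain ⟨p, hp⟩ := hG.exists_walk_length_eq_dist ⟨v, hv⟩ ⟨u, hu⟩
    cases p with
    | nil => simp at h
    | @cons _ y _ hvy p =>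
      obtain ⟨j, h1, h2, h3⟩ := (L.exists_position_iff y.is_lt hv).2 hvy.symm
      refine ⟨y, y.is_lt, j, h1, h2, h3, ?_⟩
      rw [hd u hu v hv, hd u hu y y.is_lt]
      have h4 := SimpleGraph.dist_le p
      have h5 := hG.dist_triangle (u := ⟨u, hu⟩) (v := y) (w := ⟨v, hv⟩)
      rw [SimpleGraph.dist_eq_one_iff_adj.2 hvy.symm] at h5
      rw [SimpleGraph.dist_comm] at h4 hp
      simp only [SimpleGraph.Walk.length_cons] at hp
      simp only [Fin.eta] at h4 h5 hp ⊢
      omega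
  · intro u hu v hv x hx
    rw [hd u hu v hv, hd u hu x hx, hd x hx v hv]
    exact hG.dist_triangle
  · intro u hu v hv
    rw [hd u hu v hv]
    exact SimpleGraph.dist_le_diam htop
  · obtain ⟨u, v, h⟩ := G.exists_dist_eq_diam
    exact ⟨u, u.is_lt, v, v.is_lt, by rw [hd u u.is_lt v v.is_lt]; exact h⟩

end AdjacencyLists

/-! ### The running time -/

theorem roundBound_le (q n : ℕ) : (roundBound q n : ℝ) ≤ q * (1 + Real.log n) := by
  have h1 : (0 : ℚ) ≤ q * harmonic n := by
    unfold harmonic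
    exact mul_nonneg (by positivity) (Finset.sum_nonneg fun _ _ => by positivity)
  have h2 : ((roundBound q n : ℕ) : ℚ) ≤ q * harmonic n := Nat.floor_le h1
  have h3 : (roundBound q n : ℝ) ≤ q * ((harmonic n : ℚ) : ℝ) := by exact_mod_cast h2
  exact h3.trans (mul_le_mul_of_nonneg_left (harmonic_le_one_add_log n) (by positivity))

/-- With `a` and `b` the cube roots of `m` and `n`, the threshold `S` is `a / b` up to a constant
factor, which balances the searches from the dominators against the work on pairs of vertices. -/
theorem running_time_le {n m S : ℕ} (hn : 2 ≤ n) (hm : n ≤ 2 * m) (hS0 : 0 < S) (hSn : S ≤ n)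
    (hS3 : 2 * m ≤ n * S ^ 3) (hS4 : S = 1 ∨ n * (S - 1) ^ 3 < 2 * m) :
    (((n + 2 * m) * (roundBound (n / S + 1) n + 1) + n * n * (S * S) : ℕ) : ℝ) ≤
      68 * ((m : ℝ) ^ (2 / 3 : ℝ) * (n : ℝ) ^ (4 / 3 : ℝ)) * Real.log n := by
  obtain ⟨a, ha, ham, ha2⟩ : ∃ a : ℝ, 0 ≤ a ∧ a ^ 3 = m ∧ (m : ℝ) ^ (2 / 3 : ℝ) = a ^ 2 := by
    refine ⟨(m : ℝ) ^ (1 / 3 : ℝ), by positivity, ?_, ?_⟩ <;>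
      rw [← Real.rpow_natCast, ← Real.rpow_mul (by positivity)] <;> norm_num
  obtain ⟨b, hb, hbn, hb4⟩ : ∃ b : ℝ, 0 ≤ b ∧ b ^ 3 = n ∧ (n : ℝ) ^ (4 / 3 : ℝ) = b ^ 4 := by
    refine ⟨(n : ℝ) ^ (1 / 3 : ℝ), by positivity, ?_, ?_⟩ <;>
      rw [← Real.rpow_natCast, ← Real.rpow_mul (by positivity)] <;> norm_num
  rw [ha2, hb4]
  have hm' : (n : ℝ) ≤ 2 * m := by exact_mod_cast hm
  have hS0' : (1 : ℝ) ≤ S := by exact_mod_cast hS0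
  have hSn' : (S : ℝ) ≤ n := by exact_mod_cast hSn
  have hn' : (2 : ℝ) ≤ n := by exact_mod_cast hn
  have hlog : (1 : ℝ) / 2 ≤ Real.log n := by
    have h1 := Real.log_two_gt_d9
    have h2 := Real.log_le_log (by norm_num) hn'
    linarith
  have haS : a ≤ b * S := by
    have h1 : (2 * m : ℝ) ≤ n * S ^ 3 := by exact_mod_cast hS3
    refine le_of_pow_le_pow_left₀ (n := 3) (by norm_num) (by positivity) ?_
    rw [mul_pow, ham, hbn]
    have : (0 : ℝ) ≤ m := by positivity
    linarith
  have hba : b ≤ 2 * a := by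
    refine le_of_pow_le_pow_left₀ (n := 3) (by norm_num) (by positivity) ?_
    rw [mul_pow, ham, hbn]
    have : (0 : ℝ) ≤ m := by positivity
    linarith
  have hbS : b * S ≤ 4 * a := by
    rcases hS4 with rfl | h
    · push_cast; linarith
    · have h1 : (n * (S - 1) ^ 3 : ℝ) ≤ 2 * m := by
        have h2 : ((n * (S - 1) ^ 3 : ℕ) : ℝ) ≤ ((2 * m : ℕ) : ℝ) := by exact_mod_cast h.le
        push_cast [Nat.cast_sub hS0] at h2
        exact h2
      have h3 : b * (S - 1) ≤ 2 * a := by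
        refine le_of_pow_le_pow_left₀ (n := 3) (by norm_num) (by positivity) ?_
        rw [mul_pow, mul_pow, ham, hbn]
        have : (0 : ℝ) ≤ m := by positivity
        linarith
      linarith
  -- the work on pairs
  have hpairs : (n * n * (S * S) : ℝ) ≤ 16 * (a ^ 2 * b ^ 4) := by
    have h1 : (b * S) ^ 2 ≤ (4 * a) ^ 2 := pow_le_pow_left₀ (by positivity) hbS 2
    have h2 := mul_le_mul_of_nonneg_left h1 (show 0 ≤ b ^ 4 by positivity)
    rw [← hbn]
    nlinarith
  -- the searches from the dominators
  have hround : (roundBound (n / S + 1) n + 1 : ℝ) ≤ 3 * (n / S) * (1 + Real.log n) := by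
    have h1 := roundBound_le (n / S + 1) n
    have h2 : ((n / S + 1 : ℕ) : ℝ) ≤ n / S + 1 := by
      push_cast
      exact add_le_add_left Nat.cast_div_le 1
    have h3 : (1 : ℝ) ≤ n / S := (one_le_div (by linarith)).2 hSn'
    have h4 : ((n / S + 1 : ℕ) : ℝ) * (1 + Real.log n) ≤ (2 * (n / S)) * (1 + Real.log n) :=
      mul_le_mul_of_nonneg_right (by linarith) (by linarith)
    have h5 : (1 : ℝ) * 1 ≤ (n / S) * (1 + Real.log n) :=
      mul_le_mul h3 (by linarith) (by norm_num) (by linarith)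
    linarith
  have hsearch : (m : ℝ) * (n / S) ≤ a ^ 2 * b ^ 4 := by
    rw [← mul_div_assoc, div_le_iff₀ (by linarith), ← ham, ← hbn]
    have := mul_le_mul_of_nonneg_left haS (show 0 ≤ a ^ 2 * b ^ 3 by positivity)
    linarith
  have hX : (0 : ℝ) ≤ a ^ 2 * b ^ 4 := by positivity
  push_cast
  have h1 : ((n : ℝ) + 2 * m) * (roundBound (n / S + 1) n + 1) ≤
      (4 * m) * (3 * (n / S) * (1 + Real.log n)) :=
    mul_le_mul (by linarith) hround (by positivity) (by positivity)
  have h2 : (4 * m) * (3 * ((n : ℝ) / S) * (1 + Real.log n)) ≤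
      12 * (a ^ 2 * b ^ 4) * (1 + Real.log n) := by
    have := mul_le_mul_of_nonneg_right hsearch (show 0 ≤ 1 + Real.log n by linarith)
    linarith
  have h3 := mul_le_mul_of_nonneg_left hlog hX
  nlinarith

/-- Words of `9 (⌊log₂ n⌋ + 1)` bits suffice. -/
theorem pow_four_lt_size {n : ℕ} (hn : 0 < n) :
    (n + 2) ^ 4 < WordRAM.size (9 * (Nat.log 2 n + 1)) := by
  have h1 : n + 1 ≤ 2 ^ (Nat.log 2 n + 1) := Nat.lt_pow_succ_log_self (by norm_num) n
  have h2 : (n + 1) ^ 9 ≤ WordRAM.size (9 * (Nat.log 2 n + 1)) := by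
    rw [WordRAM.size, mul_comm, pow_mul]
    exact Nat.pow_le_pow_left h1 9
  have h3 : n + 2 ≤ (n + 1) ^ 2 := by nlinarith
  calc (n + 2) ^ 4 ≤ ((n + 1) ^ 2) ^ 4 := Nat.pow_le_pow_left h3 4
    _ = (n + 1) ^ 8 := by ring
    _ < (n + 1) ^ 9 := Nat.pow_lt_pow_right (by omega) (by norm_num)
    _ ≤ _ := h2

open WordRAM in
theorem AdjacencyLists.input_bdd {n : ℕ} {G : SimpleGraph (Fin n)} (L : AdjacencyLists G)
    (hG : G.Connected) : Bdd (9 * (Nat.log 2 n + 1)) L.input := by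
  have hN := L.net hG
  have hW := pow_four_lt_size hN.pos
  refine ⟨lt_size_of_le hW (by omega), fun x => ?_, fun a i => ?_⟩
  · simp only [input]
    split
    · exact lt_size_of_le hW (by omega)
    · exact lt_size_of_le hW (by omega)
  · simp only [input]
    split
    · split
      · rename_i hi
        have := hN.le i hi
        rw [L.input_st hi] at this
        exact lt_size_of_le hW (by omega)
      · exact lt_size_of_le hW (by omega)
    · split
      · by_cases hi : i < L.flat.length
        · rw [List.getD_eq_getElem _ _ hi]
          have h1 := List.getElem_mem hi
          obtain ⟨v, -, hv⟩ := List.mem_map.1 h1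
          have := v.is_lt
          exact lt_size_of_le hW (by omega)
        · rw [List.getD_eq_default _ _ (by omega)]
          exact lt_size_of_le hW (by omega)
      · exact lt_size_of_le hW (by omega)

theorem mainTheorem6 :
    ∃ (P : WordRAM.Program) (c : ℕ) (C : ℝ) (k : ℕ),
      ∀ (n : ℕ) (G : SimpleGraph (Fin n)), G.Connected →
        ∀ L : AdjacencyLists G,
          ∃ (t : ℕ) (s : WordRAM.State),
            WordRAM.Exec (c * (Nat.log 2 n + 1)) P L.input t s ∧
            4 * G.diam / 5 ≤ s.reg 0 ∧ s.reg 0 ≤ G.diam ∧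
            (2 ≤ n →
              (t : ℝ) ≤ C * ((G.edgeSet.ncard : ℝ) ^ (2 / 3 : ℝ) * (n : ℝ) ^ (4 / 3 : ℝ)) *
                Real.log n ^ k) := by
  refine ⟨WordRAM.diameterEstimate, 9, 4000 * 68, 1, fun n G hG L => ?_⟩
  have hN := L.net hG
  obtain ⟨t, s, hE, -, h1, h2, S, hS0, hSn, hS3, hS4, ht⟩ :=
    WordRAM.wp_diameterEstimate hN (pow_four_lt_size hN.pos)
      (s := L.input) ⟨by simp [AdjacencyLists.input], rfl, rfl⟩ (by simp [AdjacencyLists.input])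
      (fun a h0 h1 i => by simp [AdjacencyLists.input, h0, h1]) (L.input_bdd hG)
  refine ⟨t, s, hE, h1, h2, fun hn => ?_⟩
  rw [L.input_st le_rfl, L.start_eq_two_mul] at hS3 hS4 ht
  have hm : n ≤ 2 * G.edgeSet.ncard := by
    have h3 := hG.card_vert_le_card_edgeSet_add_one
    rw [Nat.card_eq_fintype_card, Fintype.card_fin, Nat.card_coe_set_eq] at h3
    omega
  have h3 := running_time_le hn hm hS0 hSn hS3 hS4
  have h4 : (t : ℝ) ≤ 4000 * (((n + 2 * G.edgeSet.ncard) * (roundBound (n / S + 1) n + 1) +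
      n * n * (S * S) : ℕ) : ℝ) := by exact_mod_cast ht
  rw [pow_one]
  linarith
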